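/- **Conventions.** Indices $a,b,\dots\in\{0,\dots,10\}$ are raised and lowered with $\eta=\mathrm{diag}(-1,+1,\dots,+1)$ and repeated indices are summed over all values; $\epsilon_{0\,1\cdots 10}=+1$. Let $\Gamma_0,\dots,\Gamma_{10}$ be real $32\times 32$ matrices with $\Gamma_a\Gamma_b+\Gamma_b\Gamma_a=2\eta_{ab}$ and $\Gamma_0\Gamma_1\cdots\Gamma_{10}=1$ (the Majorana representation $\mathbf{32}$), let $\Gamma_{a_1\cdots a_p}$ be their skew-symmetrized products (with prefactor $\tfrac1{p!}$), and let $(\overline{\psi}\phi)=\psi^\alpha\eta_{\alpha\beta}\phi^\beta$ be the non-degenerate skew-symmetric pairing on $\mathbf{32}$ for which each $\Gamma_a$ is skew self-adjoint. Let $\mathrm{CE}(\widehat{\mathfrak M})$ be the free graded-commutative real superalgebra on the generators $e^a$, $e_{a_1a_2}=e_{[a_1a_2]}$, $e_{a_1\cdots a_5}=e_{[a_1\cdots a_5]}$ of bidegree $(1,\mathrm{even})$ and $\psi^\alpha,\phi^\alpha$ ($\alpha=1,\dots,32$) of bidegree $(1,\mathrm{odd})$, with sign rule $xy=(-1)^{n_xn_y+\sigma_x\sigma_y}yx$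 for elements of bidegrees $(n_x,\sigma_x)$, $(n_y,\sigma_y)$. For a parameter $s\in\mathbb R$ the differential of the hidden M-algebra $\widehat{\mathfrak M}$ is the graded derivation $\mathrm d$ of bidegree $(1,\mathrm{even})$ with $$\mathrm d\psi=0,\quad \mathrm de^a=(\overline\psi\Gamma^a\psi),\quad \mathrm de_{a_1a_2}=-(\overline\psi\Gamma_{a_1a_2}\psi),\quad \mathrm de_{a_1\cdots a_5}=(\overline\psi\Gamma_{a_1\cdots a_5}\psi),$$ $$\mathrm d\phi=2(1+s)\,\Gamma_a\psi\,e^a+\Gamma^{a_1a_2}\psi\,e_{a_1a_2}+2\big(\tfrac1{5!}+\tfrac s{6!}\big)\Gamma^{a_1\cdots a_5}\psi\,e_{a_1\cdots a_5}.$$ $\mathrm{Spin}(1,10)$, the group of products of an even number of unit vectors with spinor norm $+1$ in the Clifford algebra, acts by algebra automorphisms through the vector representation on the indices $a$ and through $\mathbf{32}$ on the indices $\alpha$. Set $$G_4=\tfrac12(\overline\psi\Gamma_{a_1a_2}\psi)e^{a_1}e^{a_2},\qquad G_7=\tfrac1{5!}(\overline\psi\Gamma_{a_1\cdots a_5}\psi)e^{a_1}\cdots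 e^{a_5},$$ and, for $s\neq0$, $$\begin{aligned}\widehat P_3={}&\alpha_0e_{a_1a_2}e^{a_1}e^{a_2}+\alpha_1e^{a_1}{}_{a_2}e^{a_2}{}_{a_3}e^{a_3}{}_{a_1}+\alpha_2e^{a_1\cdots a_4b_1}e_{b_1}{}^{b_2}e_{b_2a_1\cdots a_4}\\&+\alpha_3\epsilon_{a_1\cdots a_5b_1\cdots b_5c}e^{a_1\cdots a_5}e^{b_1\cdots b_5}e^c+\alpha_4\epsilon_{a_1a_2a_3b_1b_2b_3c_1\cdots c_5}e^{a_1a_2a_3d_1d_2}e_{d_1d_2}{}^{b_1b_2b_3}e^{c_1\cdots c_5}\\&+\beta_1(\overline\psi\Gamma_a\phi)e^a+\beta_2(\overline\psi\Gamma_{a_1a_2}\phi)e^{a_1a_2}+\beta_3(\overline\psi\Gamma_{a_1\cdots a_5}\phi)e^{a_1\cdots a_5},\end{aligned}$$ $$\alpha_0=-\tfrac{6+2s+s^2}{10s^2},\quad\alpha_1=\tfrac{6+2s}{30s^2},\quad\alpha_2=\tfrac{(6+s)^2}{2\cdot6!\,s^2},\quad\alpha_3=\tfrac{(6+s)^2}{10\cdot5!\,6!\,s^2},\quad\alpha_4=-\tfrac{(6+s)^2}{18\cdot5!\,6!\,s^2},$$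 $$\beta_1=-\tfrac{3-2s}{10s^2},\qquad\beta_2=-\tfrac{3+s}{20s^2},\qquad\beta_3=-\tfrac{3(6+s)}{10\cdot6!\,s^2}.$$ **Lemma (Induced 7-cocycle is non-trivial).** At $s=-1$ there is no $\mathrm{Spin}(1,10)$-invariant 6-form $P_6\in\mathrm{CE}(\widehat{\mathfrak M})$ (element of degree 6 in the first grading) such that $$\mathrm dP_6=G_7-\tfrac12\,G_4\,\widehat P_3 .$$ -/

import Mathlib

open scoped Kronecker

noncomputable section

namespace HiddenM

/-! ## Minkowski space, Majorana spinors and Clifford elements in 11 dimensions -/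

/-- The mostly plus Minkowski metric: `eta a` is the diagonal entry `η_{aa} = η^{aa}`. -/
def eta (a : Fin 11) : ℝ := if a = 0 then -1 else 1

/-- The factor by which all the indices of a multi-index `t` are raised or lowered. -/
def etaT {k : ℕ} (t : Fin k → Fin 11) : ℝ := ∏ i, eta (t i)

/-- The Levi-Civita symbol with lower indices, normalized to `ε_{0 1 ⋯ 10} = +1`. -/
def leviCivita (t : Fin 11 → Fin 11) : ℝ :=
  open Classical in
  if h : Function.Bijective t then ((Equiv.Perm.sign (Equiv.ofBijective t h) : ℤ) : ℝ) else 0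

def s1 : Matrix (Fin 2) (Fin 2) ℝ := !![0, 1; 1, 0]
def s3 : Matrix (Fin 2) (Fin 2) ℝ := !![1, 0; 0, -1]
def ee : Matrix (Fin 2) (Fin 2) ℝ := !![0, 1; -1, 0]

/-- The 32-element index set of the real spinor representation `𝟑𝟐`, as a fivefold tensor power
of `ℝ²`. -/
abbrev SpinorIdx : Type := Fin 2 × Fin 2 × Fin 2 × Fin 2 × Fin 2

abbrev SpinorMat : Type := Matrix SpinorIdx SpinorIdx ℝ

def kron5 (A B C D E : Matrix (Fin 2) (Fin 2) ℝ) : SpinorMat :=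
  A ⊗ₖ (B ⊗ₖ (C ⊗ₖ (D ⊗ₖ E)))

/-- The Clifford generators `Γ_a` (lower index), real `32 × 32` matrices. -/
def gamma : Fin 11 → SpinorMat :=
  ![kron5 ee 1 1 1 1,
    kron5 s1 ee ee ee ee,
    kron5 s1 ee 1 s1 ee,
    kron5 s1 ee 1 s3 ee,
    kron5 s1 ee s1 ee 1,
    kron5 s1 ee s3 ee 1,
    kron5 s1 ee ee 1 s1,
    kron5 s1 ee ee 1 s3,
    kron5 s1 s1 1 1 1,
    kron5 s1 s3 1 1 1,
    kron5 s3 1 1 1 1]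

/-- The spinor metric `η_{αβ}`, the matrix of the pairing `(φ̄ ψ) = φ^α η_{αβ} ψ^β`. -/
def spinorMetric : SpinorMat := gamma 0

theorem kron5_mul (A B C D E A' B' C' D' E' : Matrix (Fin 2) (Fin 2) ℝ) :
    kron5 A B C D E * kron5 A' B' C' D' E'
      = kron5 (A * A') (B * B') (C * C') (D * D') (E * E') := by
  simp [kron5, Matrix.mul_kronecker_mul]

theorem kron5_transpose (A B C D E : Matrix (Fin 2) (Fin 2) ℝ) :
    (kron5 A B C D E).transpose
      = kron5 A.transpose B.transpose C.transpose D.transpose E.transpose := by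
  ext i j
  simp [kron5, Matrix.kroneckerMap_apply]

theorem kron5_one : kron5 1 1 1 1 1 = 1 := by
  simp [kron5]

theorem kron5_neg1 (A B C D E : Matrix (Fin 2) (Fin 2) ℝ) :
    kron5 (-A) B C D E = -kron5 A B C D E := by
  ext i j; simp [kron5, Matrix.kroneckerMap_apply]
theorem kron5_neg2 (A B C D E : Matrix (Fin 2) (Fin 2) ℝ) :
    kron5 A (-B) C D E = -kron5 A B C D E := by
  ext i j; simp [kron5, Matrix.kroneckerMap_apply]
theorem kron5_neg3 (A B C D E : Matrix (Fin 2) (Fin 2) ℝ) :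
    kron5 A B (-C) D E = -kron5 A B C D E := by
  ext i j; simp [kron5, Matrix.kroneckerMap_apply]
theorem kron5_neg4 (A B C D E : Matrix (Fin 2) (Fin 2) ℝ) :
    kron5 A B C (-D) E = -kron5 A B C D E := by
  ext i j; simp [kron5, Matrix.kroneckerMap_apply]
theorem kron5_neg5 (A B C D E : Matrix (Fin 2) (Fin 2) ℝ) :
    kron5 A B C D (-E) = -kron5 A B C D E := by
  ext i j; simp [kron5, Matrix.kroneckerMap_apply]

theorem s1_s1 : s1 * s1 = 1 := by simp [s1, Matrix.one_fin_two]
theorem s3_s3 : s3 * s3 = 1 := by simp [s3, Matrix.one_fin_two]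
theorem ee_ee : ee * ee = -1 := by simp [ee, Matrix.one_fin_two]
theorem s1_s3 : s1 * s3 = -ee := by simp [s1, s3, ee]
theorem s3_s1 : s3 * s1 = ee := by simp [s1, s3, ee]
theorem s1_ee : s1 * ee = -s3 := by simp [s1, s3, ee]
theorem ee_s1 : ee * s1 = s3 := by simp [s1, s3, ee]
theorem s3_ee : s3 * ee = s1 := by simp [s1, s3, ee]
theorem ee_s3 : ee * s3 = -s1 := by simp [s1, s3, ee]
theorem s1_t : s1.transpose = s1 := by ext i j; fin_cases i <;> fin_cases j <;> simp [s1]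
theorem s3_t : s3.transpose = s3 := by ext i j; fin_cases i <;> fin_cases j <;> simp [s3]
theorem ee_t : ee.transpose = -ee := by ext i j; fin_cases i <;> fin_cases j <;> simp [ee]

theorem gamma_sq (a : Fin 11) : gamma a * gamma a = eta a • (1 : SpinorMat) := by
  fin_cases a <;>
    simp [gamma, eta, kron5_mul, s1_s1, s3_s3, ee_ee, kron5_neg1, kron5_neg2, kron5_neg3,
      kron5_neg4, kron5_neg5, kron5_one]

set_option maxHeartbeats 4000000 in
theorem gamma_anticomm (a b : Fin 11) (h : a < b) :
    gamma a * gamma b + gamma b * gamma a = 0 := by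
  fin_cases a <;> fin_cases b <;> first
    | exact absurd h (by decide)
    | simp [gamma, kron5_mul, s1_s1, ee_ee, s1_s3, s3_s1, s1_ee, ee_s1, s3_ee, ee_s3,
        kron5_neg1, kron5_neg2, kron5_neg3, kron5_neg4, kron5_neg5]

/-- The Clifford relation `Γ_a Γ_b + Γ_b Γ_a = 2 η_{ab}`. -/
theorem gamma_clifford (a b : Fin 11) :
    gamma a * gamma b + gamma b * gamma a
      = (if a = b then 2 * eta a else 0) • (1 : SpinorMat) := by
  rcases lt_trichotomy a b with h | h | h
  · simp [gamma_anticomm a b h, h.ne]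
  · subst h
    simp [gamma_sq, two_mul, add_smul]
  · rw [add_comm, gamma_anticomm b a h]
    simp [h.ne']

/-- The Clifford volume element is `Γ_0 Γ_1 ⋯ Γ_{10} = ε_{0 1 ⋯ 10} = 1`. -/
theorem gamma_volume : (List.ofFn gamma).prod = 1 := by
  simp [List.ofFn_succ, gamma, kron5_mul, ee_ee, s1_s3, s1_ee, kron5_neg1, kron5_neg2, kron5_neg3, kron5_neg4, kron5_neg5, kron5_one]

/-- The spinor metric is skew-symmetric. -/
theorem spinorMetric_skew : spinorMetric.transpose = -spinorMetric := by
  simp [spinorMetric, gamma, kron5_transpose, ee_t, kron5_neg1]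

/-- The spinor metric is non-degenerate. -/
theorem spinorMetric_sq : spinorMetric * spinorMetric = -1 := by
  simp [spinorMetric, gamma_sq, eta]

/-- The Clifford generators are skew self-adjoint for the spinor metric. -/
theorem gamma_skewAdjoint (a : Fin 11) :
    (gamma a).transpose * spinorMetric = -(spinorMetric * gamma a) := by
  fin_cases a <;>
    simp [spinorMetric, gamma, kron5_transpose, s1_t, s3_t, ee_t, kron5_mul, ee_ee, s1_ee,
      ee_s1, s3_ee, ee_s3, kron5_neg1, kron5_neg2, kron5_neg3, kron5_neg4, kron5_neg5]

/-- The skew-symmetrized Clifford element `Γ_{a_1 ⋯ a_k}` (lower indices), with prefactor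
`1 / k!`. -/
def cliff {k : ℕ} (t : Fin k → Fin 11) : SpinorMat :=
  ((k.factorial : ℝ)⁻¹) • ∑ σ : Equiv.Perm (Fin k),
    ((Equiv.Perm.sign σ : ℤ) : ℝ) • (List.ofFn fun i => gamma (t (σ i))).prod

/-- The Clifford element `Γ^{a_1 ⋯ a_k}` with raised indices. -/
def cliffUp {k : ℕ} (t : Fin k → Fin 11) : SpinorMat := etaT t • cliff t

theorem etaT_comp {k : ℕ} (t : Fin k → Fin 11) (τ : Equiv.Perm (Fin k)) :
    etaT (t ∘ τ) = etaT t :=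
  Equiv.prod_comp τ fun i => eta (t i)

theorem sign_mul_self (k : ℕ) (τ : Equiv.Perm (Fin k)) :
    ((Equiv.Perm.sign τ : ℤ) : ℝ) * ((Equiv.Perm.sign τ : ℤ) : ℝ) = 1 := by
  rcases Int.units_eq_one_or (Equiv.Perm.sign τ) with h | h <;> simp [h]

theorem cliff_comp {k : ℕ} (t : Fin k → Fin 11) (τ : Equiv.Perm (Fin k)) :
    cliff (t ∘ τ) = ((Equiv.Perm.sign τ : ℤ) : ℝ) • cliff t := by
  unfold cliff
  rw [smul_comm, Finset.smul_sum (r := ((Equiv.Perm.sign τ : ℤ) : ℝ))]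
  congr 1
  symm
  rw [← Equiv.sum_comp (Equiv.mulLeft τ)]
  refine Finset.sum_congr rfl fun σ _ => ?_
  simp only [Equiv.coe_mulLeft, Equiv.Perm.coe_mul, Function.comp_apply, map_mul, Units.val_mul,
    Int.cast_mul, smul_smul, ← mul_assoc, sign_mul_self, one_mul]

theorem cliffUp_comp {k : ℕ} (t : Fin k → Fin 11) (τ : Equiv.Perm (Fin k)) :
    cliffUp (t ∘ τ) = ((Equiv.Perm.sign τ : ℤ) : ℝ) • cliffUp t := by
  rw [cliffUp, cliffUp, cliff_comp, etaT_comp, smul_comm]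

/-! ## The group `Spin(1,10)` and its vector and spinor representations -/

/-- The Minkowski quadratic form on `ℝ^{1,10}`. -/
def minkowski : QuadraticForm ℝ (Fin 11 → ℝ) := QuadraticMap.weightedSumSquares ℝ eta

/-- `v ↦ v^a Γ_a`. -/
def slash : (Fin 11 → ℝ) →ₗ[ℝ] SpinorMat :=
  ∑ a, (LinearMap.proj a : (Fin 11 → ℝ) →ₗ[ℝ] ℝ).smulRight (gamma a)

theorem slash_apply (v : Fin 11 → ℝ) : slash v = ∑ a, v a • gamma a := by
  simp [slash]

theorem slash_sq (v : Fin 11 → ℝ) :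
    slash v * slash v = algebraMap ℝ SpinorMat (minkowski v) := by
  have key : slash v * slash v + slash v * slash v
      = algebraMap ℝ SpinorMat (minkowski v) + algebraMap ℝ SpinorMat (minkowski v) := by
    have h1 : slash v * slash v = ∑ a, ∑ b, (v a * v b) • (gamma a * gamma b) := by
      rw [slash_apply, Finset.sum_mul_sum]
      simp [smul_smul, mul_comm]
    have h2 : slash v * slash v = ∑ a, ∑ b, (v a * v b) • (gamma b * gamma a) := by
      rw [h1, Finset.sum_comm]
      simp [mul_comm]
    nth_rewrite 1 [h1]
    rw [h2]
    simp only [← Finset.sum_add_distrib, ← smul_add, gamma_clifford, ite_smul, zero_smul,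
      smul_ite, smul_zero, Finset.sum_ite_eq, Finset.mem_univ, if_true, smul_smul]
    rw [← Finset.sum_smul, ← map_add, Algebra.algebraMap_eq_smul_one]
    congr 1
    simp only [minkowski, QuadraticMap.weightedSumSquares_apply, smul_eq_mul,
      ← Finset.sum_add_distrib]
    exact Finset.sum_congr rfl fun a _ => by ring
  rw [← two_smul ℝ, ← two_smul ℝ (algebraMap ℝ SpinorMat (minkowski v))] at key
  exact smul_right_injective _ (two_ne_zero' ℝ) key

/-- The Clifford algebra acts on the spinors through the `Γ_a`; restricted to `spinGroup minkowski`,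
this is the spinor representation `𝟑𝟐` of `Spin(1,10)`. -/
def spinorRep : CliffordAlgebra minkowski →ₐ[ℝ] SpinorMat :=
  CliffordAlgebra.lift minkowski ⟨slash, slash_sq⟩

/-- The matrix `Λ^a{}_b` of the vector `v ↦ g v g⁻¹`, where `g⁻¹ = star g` on `Spin(1,10)`, see
`ι_vectorRep_mulVec`. -/
def vectorRep (g : CliffordAlgebra minkowski) : Matrix (Fin 11) (Fin 11) ℝ :=
  LinearMap.toMatrix'
    (ExteriorAlgebra.ιInv ∘ₗ (CliffordAlgebra.equivExterior minkowski).toLinearMap ∘ₗ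
      LinearMap.mulRight ℝ (star g) ∘ₗ LinearMap.mulLeft ℝ g ∘ₗ CliffordAlgebra.ι minkowski)

theorem ι_vectorRep_mulVec (g : CliffordAlgebra minkowski) (hg : g ∈ spinGroup minkowski)
    (v : Fin 11 → ℝ) :
    CliffordAlgebra.ι minkowski ((vectorRep g).mulVec v)
      = g * CliffordAlgebra.ι minkowski v * star g := by
  obtain ⟨w, hw⟩ := spinGroup.conjAct_smul_ι_mem_range_ι
    (x := spinGroup.toUnits ⟨g, hg⟩) (by simpa using hg) v
  have hw' : CliffordAlgebra.ι minkowski w = g * CliffordAlgebra.ι minkowski v * star g := hw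
  have h2 : (vectorRep g).mulVec v = w := by
    rw [vectorRep, ← Matrix.toLin'_apply, Matrix.toLin'_toMatrix']
    simp only [LinearMap.comp_apply, LinearMap.mulLeft_apply, LinearMap.mulRight_apply, ← hw']
    simp [CliffordAlgebra.equivExterior, CliffordAlgebra.changeForm_ι,
      ExteriorAlgebra.ι_leftInverse w]
  rw [h2, hw']

/-! ## The graded algebra underlying the Chevalley-Eilenberg algebra -/

/-- The numbers of indices of the bosonic generators. -/
abbrev Rank : Type := {k : ℕ // k = 1 ∨ k = 2 ∨ k = 5}

/-- Names of the generators: `e p t` is `e^{t_1 ⋯ t_p}` (upper indices) for `p = 1, 2, 5`, of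
bidegree `(1, even)`; `psi α` is `ψ^α` and `phi α` is `φ^α`, of bidegree `(1, odd)`. -/
inductive Gen : Type
  | e (p : Rank) (t : Fin p.1 → Fin 11) : Gen
  | psi (α : SpinorIdx) : Gen
  | phi (α : SpinorIdx) : Gen

/-- The super-degree, `0` for even and `1` for odd. -/
def Gen.superDeg : Gen → ℕ
  | .e _ _ => 0
  | .psi _ => 1
  | .phi _ => 1

/-- The sign `(-1)^{n₁ n₂ + σ₁ σ₂}` for two generators of bidegrees `(n₁, σ₁)` and `(n₂, σ₂)`;
all the generators have `n = 1`. -/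
def commSign (x y : Gen) : ℝ := (-1) ^ (1 * 1 + x.superDeg * y.superDeg)

/-- The defining relations: skew-symmetry of the bosonic generators in their indices, and graded
commutativity. -/
inductive Rel : FreeAlgebra ℝ Gen → FreeAlgebra ℝ Gen → Prop
  | skew (p : Rank) (t : Fin p.1 → Fin 11) (σ : Equiv.Perm (Fin p.1)) :
      Rel (FreeAlgebra.ι ℝ (Gen.e p (t ∘ σ)))
        (((Equiv.Perm.sign σ : ℤ) : ℝ) • FreeAlgebra.ι ℝ (Gen.e p t))
  | comm (x y : Gen) :
      Rel (FreeAlgebra.ι ℝ x * FreeAlgebra.ι ℝ y)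
        (commSign x y • (FreeAlgebra.ι ℝ y * FreeAlgebra.ι ℝ x))

/-- The free graded-commutative superalgebra
`ℝ[e^a, e_{a₁a₂} = e_{[a₁a₂]}, e_{a₁⋯a₅} = e_{[a₁⋯a₅]}, ψ^α, φ^α]`. -/
def CE : Type := RingQuot Rel

instance instRingCE : Ring CE := inferInstanceAs (Ring (RingQuot Rel))

instance instAlgebraCE : Algebra ℝ CE := inferInstanceAs (Algebra ℝ (RingQuot Rel))

/-- The quotient homomorphism from the free algebra. -/
def mkCE : FreeAlgebra ℝ Gen →ₐ[ℝ] CE := RingQuot.mkAlgHom ℝ Rel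

theorem mkCE_rel {a b : FreeAlgebra ℝ Gen} (h : Rel a b) : mkCE a = mkCE b :=
  RingQuot.mkAlgHom_rel ℝ h

theorem mkCE_surjective : Function.Surjective mkCE :=
  RingQuot.mkAlgHom_surjective ℝ Rel

/-- The generators as elements of the algebra. -/
def gen (x : Gen) : CE := mkCE (FreeAlgebra.ι ℝ x)

/-- The `n`-forms: the span of the `n`-fold products of generators. -/
def forms (n : ℕ) : Submodule ℝ CE := (Submodule.span ℝ (Set.range gen)) ^ n

/-- `e^a` -/
def e1 (a : Fin 11) : CE := gen (.e ⟨1, by decide⟩ ![a])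
/-- `e^{a b}` -/
def e2 (a b : Fin 11) : CE := gen (.e ⟨2, by decide⟩ ![a, b])
/-- `e^{t_1 ⋯ t_5}` -/
def e5 (t : Fin 5 → Fin 11) : CE := gen (.e ⟨5, by decide⟩ t)
/-- `ψ^α` -/
def psi (α : SpinorIdx) : CE := gen (.psi α)
/-- `φ^α` -/
def phi (α : SpinorIdx) : CE := gen (.phi α)

/-- The spinor bilinear `(x̄ M y) = x^α η_{αβ} M^β{}_γ y^γ`. -/
def bil (x : SpinorIdx → CE) (M : SpinorMat) (y : SpinorIdx → CE) : CE :=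
  ∑ α, ∑ γ, (spinorMetric * M) α γ • (x α * y γ)

theorem gen_skew (p : Rank) (t : Fin p.1 → Fin 11) (σ : Equiv.Perm (Fin p.1)) :
    gen (.e p (t ∘ σ)) = ((Equiv.Perm.sign σ : ℤ) : ℝ) • gen (.e p t) := by
  rw [gen, mkCE_rel (Rel.skew p t σ), map_smul, gen]

theorem gen_comm (x y : Gen) : gen x * gen y = commSign x y • (gen y * gen x) := by
  rw [gen, gen, ← map_mul, mkCE_rel (Rel.comm x y), map_smul, map_mul]

theorem commSign_symm (x y : Gen) : commSign x y = commSign y x := by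
  simp [commSign, mul_comm]

theorem commSign_sq (x y : Gen) : commSign x y * commSign x y = 1 := by
  simp [commSign, ← mul_pow]

/-- Algebra homomorphisms out of `CE` are given by values on the generators. -/
def liftCE {B : Type} [Ring B] [Algebra ℝ B] (f : Gen → B)
    (hs : ∀ (p : Rank) (t : Fin p.1 → Fin 11) (σ : Equiv.Perm (Fin p.1)),
      f (.e p (t ∘ σ)) = ((Equiv.Perm.sign σ : ℤ) : ℝ) • f (.e p t))
    (hc : ∀ x y, f x * f y = commSign x y • (f y * f x)) : CE →ₐ[ℝ] B :=
  RingQuot.liftAlgHom ℝ ⟨FreeAlgebra.lift ℝ f, by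
    intro a b h
    cases h with
    | skew p t σ => simpa using hs p t σ
    | comm x y => simpa using hc x y⟩

theorem liftCE_gen {B : Type} [Ring B] [Algebra ℝ B] (f : Gen → B)
    (hs : ∀ (p : Rank) (t : Fin p.1 → Fin 11) (σ : Equiv.Perm (Fin p.1)),
      f (.e p (t ∘ σ)) = ((Equiv.Perm.sign σ : ℤ) : ℝ) • f (.e p t))
    (hc : ∀ x y, f x * f y = commSign x y • (f y * f x)) (x : Gen) :
    liftCE f hs hc (gen x) = f x := by
  have h := RingQuot.liftAlgHom_mkAlgHom_apply (S := ℝ) (s := Rel) (FreeAlgebra.lift ℝ f)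
    (by
      intro a b h
      cases h with
      | skew p t σ => simpa using hs p t σ
      | comm x y => simpa using hc x y) (FreeAlgebra.ι ℝ x)
  rw [FreeAlgebra.lift_ι_apply] at h
  exact h

theorem algHom_ext {B : Type} [Ring B] [Algebra ℝ B] {f g : CE →ₐ[ℝ] B}
    (h : ∀ x, f (gen x) = g (gen x)) : f = g :=
  RingQuot.ringQuot_ext' ℝ f g (FreeAlgebra.hom_ext (funext h))

/-! ## The action of `Spin(1,10)` -/

/-- The values on generators of the transformation with spinor matrix `S` and vector matrix `L`. -/
def actGen (S : SpinorMat) (L : Matrix (Fin 11) (Fin 11) ℝ) : Gen → CE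
  | .e p t => ∑ u : Fin p.1 → Fin 11, (∏ i, L (t i) (u i)) • gen (.e p u)
  | .psi α => ∑ β, S α β • psi β
  | .phi α => ∑ β, S α β • phi β

theorem sum_mul_sum_comm {I J : Type} [Fintype I] [Fintype J] (c : ℝ) (f : I → ℝ) (g : J → ℝ)
    (x : I → Gen) (y : J → Gen) (h : ∀ i j, commSign (x i) (y j) = c) :
    (∑ i, f i • gen (x i)) * (∑ j, g j • gen (y j))
      = c • ((∑ j, g j • gen (y j)) * (∑ i, f i • gen (x i))) := by
  rw [Finset.sum_mul_sum, Finset.sum_mul_sum, Finset.sum_comm, Finset.smul_sum]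
  refine Finset.sum_congr rfl fun j _ => ?_
  rw [Finset.smul_sum]
  refine Finset.sum_congr rfl fun i _ => ?_
  rw [smul_mul_smul_comm, smul_mul_smul_comm, gen_comm (x i) (y j), h, smul_smul, smul_smul]
  congr 1
  ring

/-- The algebra automorphism `e^{a_1 ⋯ a_p} ↦ L^{a_1}{}_{b_1} ⋯ L^{a_p}{}_{b_p} e^{b_1 ⋯ b_p}`,
`ψ^α ↦ S^α{}_β ψ^β`, `φ^α ↦ S^α{}_β φ^β`. -/
def act (S : SpinorMat) (L : Matrix (Fin 11) (Fin 11) ℝ) : CE →ₐ[ℝ] CE :=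
  liftCE (actGen S L)
    (by
      intro p t σ
      simp only [actGen, Finset.smul_sum]
      rw [← Equiv.sum_comp (σ.arrowCongr (Equiv.refl (Fin 11)))
        (fun u => ((Equiv.Perm.sign σ : ℤ) : ℝ) • (∏ i, L (t i) (u i)) • gen (.e p u))]
      refine Finset.sum_congr rfl fun u _ => ?_
      have hu : u = ((σ.arrowCongr (Equiv.refl (Fin 11))) u) ∘ σ := by
        ext i; simp [Equiv.arrowCongr]
      have hg := gen_skew p ((σ.arrowCongr (Equiv.refl (Fin 11))) u) σ
      rw [← hu] at hg
      rw [hg, smul_comm]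
      congr 2
      rw [← Equiv.prod_comp σ
        (fun i => L (t i) ((σ.arrowCongr (Equiv.refl (Fin 11))) u i))]
      refine Finset.prod_congr rfl fun i _ => ?_
      simp [Equiv.arrowCongr])
    (by
      intro x y
      cases x <;> cases y <;>
        exact sum_mul_sum_comm _ _ _ _ _ (fun _ _ => rfl))

theorem act_gen (S : SpinorMat) (L : Matrix (Fin 11) (Fin 11) ℝ) (x : Gen) :
    act S L (gen x) = actGen S L x :=
  liftCE_gen _ _ _ x

/-- Invariance under `Spin(1,10)`. -/
def IsSpinInvariant (P : CE) : Prop :=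
  ∀ g ∈ spinGroup minkowski, act (spinorRep g) (vectorRep g) P = P

/-! ## The differential of the hidden M-algebra -/

/-- The sign in `d e^{a_1 ⋯ a_p} = ± (ψ̄ Γ^{a_1 ⋯ a_p} ψ)`: minus for `p = 2` only. -/
def bosSign (p : Rank) : ℝ := if p.1 = 2 then -1 else 1

def delta (s : ℝ) : ℝ := 2 * (1 + s)
def gamma1 (_s : ℝ) : ℝ := 1
def gamma2 (s : ℝ) : ℝ := 2 * (1 / Nat.factorial 5 + s / Nat.factorial 6)

/-- The differential on generators, for the parameter `s`. -/
def dGen (s : ℝ) : Gen → CE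
  | .e p t => bosSign p • bil psi (cliffUp t) psi
  | .psi _ => 0
  | .phi α =>
      delta s • (∑ a : Fin 11, ∑ β, cliff ![a] α β • (psi β * e1 a))
      + gamma1 s • (∑ a : Fin 11, ∑ b : Fin 11, ∑ β, cliff ![a, b] α β • (psi β * e2 a b))
      + gamma2 s • (∑ t : Fin 5 → Fin 11, ∑ β, cliff t α β • (psi β * e5 t))

theorem fermi_mul_gen (α β : SpinorIdx) (y : Gen) :
    psi α * psi β * gen y = gen y * (psi α * psi β) := by
  have h : commSign (.psi α) y * commSign (.psi β) y = 1 := by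
    have : commSign (.psi α) y = commSign (.psi β) y := rfl
    rw [this, commSign_sq]
  rw [psi, psi, mul_assoc, gen_comm (.psi β) y, mul_smul_comm, ← mul_assoc,
    gen_comm (.psi α) y, smul_mul_assoc, smul_smul, mul_comm (commSign _ _), h, one_smul,
    mul_assoc]

theorem psi_e_mul_gen (β γ : SpinorIdx) (p : Rank) (t : Fin p.1 → Fin 11) (y : Gen) :
    psi β * gen (.e p t) * gen y = (-commSign (.phi γ) y) • (gen y * (psi β * gen (.e p t))) := by
  have h : commSign (.e p t) y * commSign (.psi β) y = -commSign (.phi γ) y := by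
    cases y <;> simp [commSign, Gen.superDeg]
  rw [psi, mul_assoc, gen_comm (.e p t) y, mul_smul_comm, ← mul_assoc,
    gen_comm (.psi β) y, smul_mul_assoc, smul_smul, h, mul_assoc]

theorem dGen_mul_gen (s : ℝ) (x y : Gen) :
    dGen s x * gen y = (-commSign x y) • (gen y * dGen s x) := by
  cases x with
  | e p t =>
    have h : -commSign (.e p t) y = 1 := by simp [commSign, Gen.superDeg]
    simp only [h, one_smul, dGen, bil, Finset.mul_sum, Finset.sum_mul, mul_smul_comm,
      smul_mul_assoc, fermi_mul_gen]
  | psi α => simp [dGen]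
  | phi α =>
    simp only [dGen, e1, e2, e5, add_mul, mul_add, Finset.mul_sum, Finset.sum_mul, mul_smul_comm,
      smul_mul_assoc, psi_e_mul_gen _ α, smul_add, Finset.smul_sum]
    simp only [smul_smul]
    simp only [mul_assoc, mul_comm]

theorem dGen_skew (s : ℝ) (p : Rank) (t : Fin p.1 → Fin 11) (σ : Equiv.Perm (Fin p.1)) :
    dGen s (.e p (t ∘ σ)) = ((Equiv.Perm.sign σ : ℤ) : ℝ) • dGen s (.e p t) := by
  simp only [dGen, bil, cliffUp_comp, Matrix.mul_smul, Matrix.smul_apply, Finset.smul_sum,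
    smul_smul, smul_eq_mul]
  simp only [mul_assoc, mul_comm]

/-- The homomorphism `x ↦ ((-1)^{deg x} x, d x; 0, x)`, whose multiplicativity encodes the graded
Leibniz rule. -/
def dMat (s : ℝ) : CE →ₐ[ℝ] Matrix (Fin 2) (Fin 2) CE :=
  liftCE (fun x => !![-gen x, dGen s x; 0, gen x])
    (by
      intro p t σ
      ext i j
      fin_cases i <;> fin_cases j <;> simp [gen_skew p t σ, dGen_skew s p t σ])
    (by
      intro x y
      have h1 := dGen_mul_gen s x y
      have h2 := dGen_mul_gen s y x
      have h3 : gen x * dGen s y = (-commSign x y) • (dGen s y * gen x) := by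
        rw [h2, smul_smul, commSign_symm y x, neg_mul_neg, commSign_sq, one_smul]
      ext i j
      fin_cases i <;> fin_cases j <;>
        simp [Matrix.mul_apply, Fin.sum_univ_two, gen_comm x y, h1, h3, add_comm])

/-- The differential of the Chevalley-Eilenberg algebra of the hidden M-algebra with parameter `s`:
the graded derivation with values `dGen s` on generators, see `d_gen` and `d_mul`. -/
def d (s : ℝ) : CE →ₗ[ℝ] CE where
  toFun x := dMat s x 0 1
  map_add' x y := by simp
  map_smul' c x := by simp

/-- The automorphism `x ↦ (-1)^n x` on `n`-forms. -/
def degSign : CE →ₐ[ℝ] CE :=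
  liftCE (fun x => -gen x) (fun p t σ => by simp [gen_skew p t σ])
    (fun x y => by simpa using gen_comm x y)

theorem dMat_gen (s : ℝ) (x : Gen) : dMat s (gen x) = !![-gen x, dGen s x; 0, gen x] :=
  liftCE_gen _ _ _ x

theorem degSign_gen (x : Gen) : degSign (gen x) = -gen x :=
  liftCE_gen _ _ _ x

theorem d_gen (s : ℝ) (x : Gen) : d s (gen x) = dGen s x := by
  simp [d, dMat_gen]

theorem dMat_shape (s : ℝ) (x : CE) :
    dMat s x 0 0 = degSign x ∧ dMat s x 1 0 = 0 ∧ dMat s x 1 1 = x := by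
  obtain ⟨x, rfl⟩ := mkCE_surjective x
  induction x using FreeAlgebra.induction with
  | grade0 r =>
    rw [AlgHom.commutes, AlgHom.commutes, AlgHom.commutes]
    simp [Matrix.algebraMap_matrix_apply]
  | grade1 x =>
    change dMat s (gen x) 0 0 = degSign (gen x) ∧ dMat s (gen x) 1 0 = 0
      ∧ dMat s (gen x) 1 1 = gen x
    simp [dMat_gen, degSign_gen]
  | mul a b ha hb =>
    obtain ⟨a1, a2, a3⟩ := ha
    obtain ⟨b1, b2, b3⟩ := hb
    simp only [map_mul]
    simp [Matrix.mul_apply, Fin.sum_univ_two, a1, a2, a3, b1, b2, b3]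
  | add a b ha hb =>
    obtain ⟨a1, a2, a3⟩ := ha
    obtain ⟨b1, b2, b3⟩ := hb
    simp only [map_add]
    simp [a1, a2, a3, b1, b2, b3]

/-- The graded Leibniz rule `d (x y) = (d x) y + (-1)^{deg x} x (d y)`. -/
theorem d_mul (s : ℝ) (x y : CE) : d s (x * y) = d s x * y + degSign x * d s y := by
  have h1 := dMat_shape s x
  have h2 := dMat_shape s y
  simp [d, Matrix.mul_apply, Fin.sum_univ_two, h1.1, h2.2.2, add_comm]

/-! ## The flux densities and the hidden 3-form -/

/-- `G_4 = ½ (ψ̄ Γ_{ab} ψ) e^a e^b`. -/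
def G4 : CE :=
  (1 / 2 : ℝ) • ∑ a, ∑ b, bil psi (cliff ![a, b]) psi * e1 a * e1 b

/-- `G_7 = (1/5!) (ψ̄ Γ_{a_1 ⋯ a_5} ψ) e^{a_1} ⋯ e^{a_5}`. -/
def G7 : CE :=
  (1 / (Nat.factorial 5 : ℝ)) • ∑ t : Fin 5 → Fin 11,
    bil psi (cliff t) psi * (List.ofFn fun i => e1 (t i)).prod

def alpha0 (s : ℝ) : ℝ := 1 / 2 * (-1 / 5) * ((6 + 2 * s + s ^ 2) / s ^ 2)
def alpha1 (s : ℝ) : ℝ := 1 / 2 * (1 / 15) * ((6 + 2 * s) / s ^ 2)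
def alpha2 (s : ℝ) : ℝ := 1 / 2 * (1 / Nat.factorial 6) * ((6 + s) ^ 2 / s ^ 2)
def alpha3 (s : ℝ) : ℝ :=
  1 / 2 * (1 / (5 * Nat.factorial 5 * Nat.factorial 6)) * ((6 + s) ^ 2 / s ^ 2)
def alpha4 (s : ℝ) : ℝ :=
  1 / 2 * (-1 / (9 * Nat.factorial 5 * Nat.factorial 6)) * ((6 + s) ^ 2 / s ^ 2)
def beta1 (s : ℝ) : ℝ := -1 * (1 / 10) * ((3 - 2 * s) / s ^ 2)
def beta2 (s : ℝ) : ℝ := -1 * (1 / 20) * ((3 + s) / s ^ 2)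
def beta3 (s : ℝ) : ℝ := -1 * (3 / (10 * Nat.factorial 6)) * ((6 + s) / s ^ 2)

/-- The hidden 3-form, for `s ≠ 0`:
`α₀ e_{ab} e^a e^b + α₁ e^a{}_b e^b{}_c e^c{}_a
  + α₂ e^{a_1⋯a_4 b} e_b{}^c e_{c a_1⋯a_4}
  + α₃ ε_{a_1⋯a_5 b_1⋯b_5 c} e^{a_1⋯a_5} e^{b_1⋯b_5} e^c
  + α₄ ε_{a_1a_2a_3 b_1b_2b_3 c_1⋯c_5} e^{a_1a_2a_3 d_1d_2} e_{d_1d_2}{}^{b_1b_2b_3} e^{c_1⋯c_5}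
  + β₁ (ψ̄ Γ_a φ) e^a + β₂ (ψ̄ Γ_{ab} φ) e^{ab} + β₃ (ψ̄ Γ_{a_1⋯a_5} φ) e^{a_1⋯a_5}`. -/
def P3 (s : ℝ) : CE :=
  alpha0 s • (∑ a, ∑ b, (eta a * eta b) • (e2 a b * e1 a * e1 b))
  + alpha1 s • (∑ a, ∑ b, ∑ c, (eta a * eta b * eta c) • (e2 a b * e2 b c * e2 c a))
  + alpha2 s • (∑ a : Fin 4 → Fin 11, ∑ b, ∑ c, (etaT a * eta b * eta c) •
      (e5 (Fin.append a ![b]) * e2 b c * e5 (Fin.append ![c] a)))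
  + alpha3 s • (∑ a : Fin 5 → Fin 11, ∑ b : Fin 5 → Fin 11, ∑ c,
      leviCivita (Fin.append (Fin.append a b) ![c]) • (e5 a * e5 b * e1 c))
  + alpha4 s • (∑ a : Fin 3 → Fin 11, ∑ b : Fin 3 → Fin 11, ∑ c : Fin 5 → Fin 11,
      ∑ f : Fin 2 → Fin 11, (leviCivita (Fin.append (Fin.append a b) c) * etaT f) •
        (e5 (Fin.append a f) * e5 (Fin.append f b) * e5 c))
  + beta1 s • (∑ a, bil psi (cliff ![a]) phi * e1 a)
  + beta2 s • (∑ a, ∑ b, bil psi (cliff ![a, b]) phi * e2 a b)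
  + beta3 s • (∑ t : Fin 5 → Fin 11, bil psi (cliff t) phi * e5 t)

end HiddenM

end

open scoped Kronecker

noncomputable section

namespace HiddenM

/-! ## Contractions -/

/-! The point of s = -1 is that the coefficient 2(1+s) of Γ_a ψ e^a in dφ vanishes, so no generator
has a differential containing e^a. The derivations ∂/∂e^a therefore anticommute with d (`contr_d`).
Contracting a hypothetical six-form P with the duals of e^1, e^2, e^3, e^4 gives a two-form Q, and
dQ is the same contraction of G_7 - ½ G_4 P_3.

With A = 12345, B = 12567, C = 34567, the functional `obstruction` on three-forms adds up three
components of type ψψe: (ψ̄Γ_Aψ)e^5, (ψ̄Γ_5ψ)e^A and (ψ̄Γ_Cψ)e^B. Components are extracted by trace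
orthogonality of Clifford elements (`trace_cliff`). On dQ, the contributions of φψ cancel: Γ_A Γ_0
Γ_5 and Γ_B Γ_0 Γ_C are opposite multiples of Γ_{1234} Γ_0, and the (ψ̄Γ_Aψ)e^5 component does not
see φψ, again because dφ lacks e^a. The product e^A e^5 contributes twice with opposite signs. Only
e^B e^C survives, so the functional equals -64 times the coefficient of e^B e^C in Q
(`obstruction_d`).

That coefficient vanishes by invariance (`coeffBC_eq_zero`). The coordinate permutation exchanging
1, 2 with 3, 4 lifts to Spin(1,10); it fixes e^1 e^2 e^3 e^4 and turns e^B e^C into e^C e^B = -e^B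
e^C.

On the other side the value is 64 (`obstruction_sevenForm`), coming entirely from (ψ̄Γ_{12345}ψ)
e^1⋯e^5 in G_7. The term G_4 P_3 contributes nothing: every monomial of P_3 contains some e^{ab},
e^{a_1⋯a_5} or φ, and still does after one five-index generator is removed. The coefficients of P_3
thus play no role, and 64 = 0 is the contradiction. -/

/-- Linear forms on the generators of super-degree `k`. -/
structure Covector (k : ℕ) where
  val : Gen → ℝ
  skew : ∀ (p : Rank) (t : Fin p.1 → Fin 11) (σ : Equiv.Perm (Fin p.1)),
    val (.e p (t ∘ σ)) = ((Equiv.Perm.sign σ : ℤ) : ℝ) * val (.e p t)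
  supp : ∀ x, x.superDeg ≠ k → val x = 0

/-- The sign for commuting an object of bidegree `(1, k)` past a generator. -/
def passSign (k : ℕ) (x : Gen) : ℝ := (-1) ^ (1 + k * x.superDeg)

/-- On the support of the covector the super-degree is `k`, so the two signs agree there. This makes
contraction compatible with graded commutativity. -/
theorem Covector.val_mul_commSign {k : ℕ} (v : Covector k) (x y : Gen) :
    v.val x * commSign x y = v.val x * passSign k y := by
  by_cases h : x.superDeg = k
  · simp [commSign, passSign, h]
  · simp [v.supp x h]

/-- The homomorphism encoding the contraction with a covector. -/
def contrMat {k : ℕ} (v : Covector k) : CE →ₐ[ℝ] Matrix (Fin 2) (Fin 2) CE :=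
  liftCE (fun x => !![passSign k x • gen x, algebraMap ℝ CE (v.val x); 0, gen x])
    (by
      intro p t σ
      have h : passSign k (.e p (t ∘ σ)) = passSign k (.e p t) := rfl
      ext i j
      fin_cases i <;> fin_cases j <;>
        simp [gen_skew p t σ, v.skew p t σ, h, smul_comm (passSign k _),
          Algebra.algebraMap_eq_smul_one, mul_smul])
    (by
      intro x y
      have h1 := v.val_mul_commSign x y
      have h2 := v.val_mul_commSign y x
      rw [commSign_symm y x] at h2
      ext i j
      fin_cases i <;> fin_cases j
      · simp [Matrix.mul_apply, Fin.sum_univ_two, gen_comm x y, smul_smul]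
        congr 1
        ring
      · simp only [Algebra.algebraMap_eq_smul_one]
        simp [Matrix.mul_apply, Fin.sum_univ_two, smul_smul]
        have e1 : v.val y * passSign k x = commSign x y * v.val y := by rw [← h2, mul_comm]
        have e2 : commSign x y * (passSign k y * v.val x) = v.val x := by
          rw [mul_comm (passSign k y), ← h1, mul_left_comm, commSign_sq, mul_one]
        rw [e1, e2, add_comm]
      · simp [Matrix.mul_apply, Fin.sum_univ_two]
      · simp [Matrix.mul_apply, Fin.sum_univ_two, gen_comm x y])

/-- The contraction with a covector. -/
def contr {k : ℕ} (v : Covector k) : CE →ₗ[ℝ] CE where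
  toFun x := contrMat v x 0 1
  map_add' x y := by simp
  map_smul' c x := by simp

theorem contrMat_gen {k : ℕ} (v : Covector k) (x : Gen) :
    contrMat v (gen x)
      = !![passSign k x • gen x, algebraMap ℝ CE (v.val x); 0, gen x] :=
  liftCE_gen _ _ _ x

/-- A subspace containing `1` and stable under left multiplication by the
generators is everything. -/
theorem mem_of_gen_mul (S : Submodule ℝ CE) (h1 : (1 : CE) ∈ S)
    (h : ∀ x w, w ∈ S → gen x * w ∈ S) (w : CE) : w ∈ S := by
  obtain ⟨a, rfl⟩ := mkCE_surjective w
  suffices ∀ w ∈ S, mkCE a * w ∈ S by simpa using this 1 h1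
  induction a using FreeAlgebra.induction with
  | grade0 r => intro w hw; simpa [Algebra.algebraMap_eq_smul_one] using S.smul_mem r hw
  | grade1 x => exact fun w hw => h x w hw
  | mul a b ha hb => intro w hw; rw [map_mul, mul_assoc]; exact ha _ (hb _ hw)
  | add a b ha hb => intro w hw; rw [map_add, add_mul]; exact S.add_mem (ha _ hw) (hb _ hw)

/-- Linear maps are determined by induction on left multiplication by generators. -/
theorem linearMap_eq_of_gen_mul {M : Type} [AddCommGroup M] [Module ℝ M] (f g : CE →ₗ[ℝ] M)
    (h1 : f 1 = g 1) (h : ∀ x w, f w = g w → f (gen x * w) = g (gen x * w)) (w : CE) :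
    f w = g w :=
  mem_of_gen_mul (LinearMap.eqLocus f g) h1 h w

/-- Upper triangularity with `w` itself in the lower corner turns multiplicativity of `contrMat`
into the signed Leibniz rule `contr_gen_mul`. -/
theorem contrMat_shape {k : ℕ} (v : Covector k) (w : CE) :
    contrMat v w 1 0 = 0 ∧ contrMat v w 1 1 = w := by
  refine mem_of_gen_mul
    { carrier := {w | contrMat v w 1 0 = 0 ∧ contrMat v w 1 1 = w}
      add_mem' := fun ha hb => by simp_all
      zero_mem' := by simp
      smul_mem' := fun c x hx => by simp_all } ?_ ?_ w
  · simp
  · rintro x w ⟨h0, h1⟩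
    simp [Matrix.mul_apply, contrMat_gen, h0, h1]

theorem contr_one {k : ℕ} (v : Covector k) : contr v 1 = 0 := by
  simp [contr]

theorem contr_gen_mul {k : ℕ} (v : Covector k) (x : Gen) (w : CE) :
    contr v (gen x * w) = v.val x • w + passSign k x • (gen x * contr v w) := by
  have h := contrMat_shape v w
  simp [contr, Matrix.mul_apply, contrMat_gen, h.2, add_comm, Algebra.algebraMap_eq_smul_one]

theorem contr_gen {k : ℕ} (v : Covector k) (x : Gen) :
    contr v (gen x) = v.val x • 1 := by
  simpa [contr_one] using contr_gen_mul v x 1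

/-- Each bosonic contraction picks up -1 past every generator, so two of them anticommute. -/
theorem contr_contr (v w : Covector 0) (x : CE) :
    contr v (contr w x) = -contr w (contr v x) := by
  refine linearMap_eq_of_gen_mul (contr v ∘ₗ contr w) (-(contr w ∘ₗ contr v)) ?_ ?_ x
  · simp [contr_one]
  · intro y x h
    simp only [LinearMap.comp_apply, LinearMap.neg_apply] at h ⊢
    simp only [contr_gen_mul, map_add, map_smul, smul_add, h]
    simp [passSign]
    abel

theorem contr_forms {k : ℕ} (v : Covector k) (n : ℕ) {w : CE} (hw : w ∈ forms (n + 1)) :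
    contr v w ∈ forms n := by
  induction n generalizing w with
  | zero =>
    rw [forms, zero_add, pow_one] at hw
    rw [forms, pow_zero]
    induction hw using Submodule.span_induction with
    | mem x hx =>
      obtain ⟨y, rfl⟩ := hx
      rw [contr_gen]
      exact Submodule.smul_mem _ _ (Submodule.one_le.mp le_rfl)
    | zero => simp
    | add x y _ _ hx hy => rw [map_add]; exact add_mem hx hy
    | smul c x _ hx => rw [map_smul]; exact Submodule.smul_mem _ _ hx
  | succ n ih =>
    rw [forms, pow_succ'] at hw
    refine Submodule.mul_induction_on hw (fun x hx w hw => ?_)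
      (fun x y hx hy => by rw [map_add]; exact add_mem hx hy)
    · have hw : w ∈ forms (n + 1) := hw
      induction hx using Submodule.span_induction with
      | mem x hx =>
        obtain ⟨y, rfl⟩ := hx
        rw [contr_gen_mul]
        refine add_mem (Submodule.smul_mem _ _ hw) (Submodule.smul_mem _ _ ?_)
        rw [forms, pow_succ']
        exact Submodule.mul_mem_mul (Submodule.subset_span ⟨y, rfl⟩) (ih hw)
      | zero => simp
      | add x y _ _ hx hy => rw [add_mul, map_add]; exact add_mem hx hy
      | smul c x _ hx => rw [smul_mul_assoc, map_smul]; exact Submodule.smul_mem _ _ hx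

/-- Linear forms vanishing on products of two generators vanish on `2`-forms. -/
theorem eq_zero_of_forms_two (f : CE →ₗ[ℝ] ℝ) (h : ∀ x y, f (gen x * gen y) = 0) {w : CE}
    (hw : w ∈ forms 2) : f w = 0 := by
  rw [forms, sq, Submodule.span_mul_span] at hw
  induction hw using Submodule.span_induction with
  | mem x hx =>
    obtain ⟨_, ⟨a, rfl⟩, _, ⟨b, rfl⟩, rfl⟩ := hx
    exact h a b
  | zero => simp
  | add x y _ _ hx hy => simp [hx, hy]
  | smul c x _ hx => simp [hx]

/-! ### Augmentation and dual covectors -/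

/-- The augmentation, which annihilates all the generators. -/
def counit : CE →ₐ[ℝ] ℝ := liftCE (fun _ => 0) (by simp) (by simp)

theorem counit_gen (x : Gen) : counit (gen x) = 0 := liftCE_gen _ _ _ x

/-- The form dual to the bosonic generator with the list `l` of indices. -/
def bosForm (l : List (Fin 11)) : Gen → ℝ
  | .e _ t => ∑ σ : Equiv.Perm (Fin _), ((Equiv.Perm.sign σ : ℤ) : ℝ) *
      if List.ofFn (t ∘ σ) = l then 1 else 0
  | .psi _ => 0
  | .phi _ => 0

/-- The covector dual to the bosonic generator with the list `l` of indices. -/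
def bosCov (l : List (Fin 11)) : Covector 0 where
  val := bosForm l
  skew := by
    intro p t τ
    simp only [bosForm, Finset.mul_sum]
    rw [← Equiv.sum_comp (Equiv.mulLeft τ) fun σ : Equiv.Perm (Fin p.1) =>
      ((Equiv.Perm.sign τ : ℤ) : ℝ) * (((Equiv.Perm.sign σ : ℤ) : ℝ) *
      if List.ofFn (t ∘ σ) = l then 1 else 0)]
    refine Finset.sum_congr rfl fun σ _ => ?_
    simp only [Equiv.coe_mulLeft, Equiv.Perm.coe_mul, map_mul, Units.val_mul, Int.cast_mul,
      ← mul_assoc, sign_mul_self, one_mul, Function.comp_assoc]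
    rfl
  supp := by
    intro x hx
    cases x <;> simp_all [Gen.superDeg, bosForm]

/-- The covector dual to `ψ^α`. -/
def psiCov (α : SpinorIdx) : Covector 1 where
  val
    | .psi β => if β = α then 1 else 0
    | _ => 0
  skew := by simp
  supp := by
    intro x hx
    cases x <;> simp_all [Gen.superDeg]

theorem psiCov_e (α : SpinorIdx) (p : Rank) (t : Fin p.1 → Fin 11) :
    (psiCov α).val (.e p t) = 0 := rfl
theorem psiCov_psi (α β : SpinorIdx) : (psiCov α).val (.psi β) = if β = α then 1 else 0 := rfl
theorem psiCov_phi (α β : SpinorIdx) : (psiCov α).val (.phi β) = 0 := rfl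
theorem bosCov_val (l : List (Fin 11)) : (bosCov l).val = bosForm l := rfl
theorem bosForm_psi (l : List (Fin 11)) (β : SpinorIdx) : bosForm l (.psi β) = 0 := rfl
theorem bosForm_phi (l : List (Fin 11)) (β : SpinorIdx) : bosForm l (.phi β) = 0 := rfl

theorem bosForm_eq_zero (l : List (Fin 11)) (p : Rank) (t : Fin p.1 → Fin 11)
    (h : p.1 ≠ l.length) : bosForm l (.e p t) = 0 := by
  refine Finset.sum_eq_zero fun σ _ => ?_
  rw [if_neg, mul_zero]
  rintro rfl
  simp at h

theorem bosForm_singleton (a b : Fin 11) (h : 1 = 1 ∨ 1 = 2 ∨ 1 = 5) :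
    bosForm [a] (.e ⟨1, h⟩ ![b]) = if b = a then 1 else 0 := by
  simp [bosForm]

theorem passSign_zero (x : Gen) : passSign 0 x = -1 := by simp [passSign]
theorem passSign_one_psi (α : SpinorIdx) : passSign 1 (.psi α) = 1 := by
  simp [passSign, Gen.superDeg]
/-! ## Products of anticommuting elements -/

/-- Induction on the position of the swap: at the front it is a single anticommutation, otherwise
the first factor splits off. -/
theorem prod_ofFn_swap_succ {R : Type} [Ring R] {n : ℕ} (x : Fin (n + 1) → R)
    (hx : ∀ i j, i ≠ j → x i * x j = -(x j * x i)) (i : Fin n) :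
    (List.ofFn (x ∘ Equiv.swap i.castSucc i.succ)).prod = -(List.ofFn x).prod := by
  induction n with
  | zero => exact i.elim0
  | succ n ih =>
    refine Fin.cases ?_ (fun j => ?_) i
    · rw [List.ofFn_succ, List.ofFn_succ, List.ofFn_succ (f := x), List.ofFn_succ]
      have h : ∀ k : Fin n, Equiv.swap (0 : Fin (n + 1)).castSucc (0 : Fin (n + 1)).succ k.succ.succ
          = k.succ.succ := fun k => Equiv.swap_apply_of_ne_of_ne
            (by simp) (by simp [Fin.ext_iff])
      simp only [Function.comp_apply, List.prod_cons, h, ← mul_assoc]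
      have h0 : Equiv.swap (0 : Fin (n + 1)).castSucc (0 : Fin (n + 1)).succ 0
        = (0 : Fin (n + 1)).succ := Equiv.swap_apply_left _ _
      have h1 : Equiv.swap (0 : Fin (n + 1)).castSucc (0 : Fin (n + 1)).succ (0 : Fin (n + 1)).succ
        = 0 := Equiv.swap_apply_right _ _
      rw [h0, h1, hx (0 : Fin (n + 1)).succ 0 (by simp), neg_mul]
    · rw [List.ofFn_succ, List.ofFn_succ (f := x)]
      have h0 : Equiv.swap j.succ.castSucc j.succ.succ 0 = 0 := Equiv.swap_apply_of_ne_of_ne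
        (by simp [Fin.ext_iff]) (by simp [Fin.ext_iff])
      have h : (fun k => (x ∘ Equiv.swap j.succ.castSucc j.succ.succ) k.succ)
          = (fun k => x k.succ) ∘ Equiv.swap j.castSucc j.succ := by
        funext k
        have := (Fin.succ_injective (n + 1)).swap_apply j.castSucc j.succ k
        simp only [Function.comp_apply, ← this, Fin.succ_castSucc]
      rw [h, List.prod_cons, ih (fun k => x k.succ) (fun a b hab => hx _ _ (by simpa using hab))]
      simp only [Function.comp_apply, h0, mul_neg, List.prod_cons]

/-- Products of pairwise anticommuting elements are skew-symmetric. -/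
theorem prod_ofFn_comp_perm {R : Type} [Ring R] [Algebra ℝ R] {n : ℕ} (x : Fin n → R)
    (hx : ∀ i j, i ≠ j → x i * x j = -(x j * x i)) (σ : Equiv.Perm (Fin n)) :
    (List.ofFn (x ∘ σ)).prod = ((Equiv.Perm.sign σ : ℤ) : ℝ) • (List.ofFn x).prod := by
  cases n with
  | zero => simp [Subsingleton.elim σ 1]
  | succ n =>
    -- Adjacent transpositions generate the symmetric group as a monoid.
    have h : σ ∈ Submonoid.closure
        (Set.range fun i : Fin n => Equiv.swap i.castSucc i.succ) := by
      rw [Equiv.Perm.mclosure_swap_castSucc_succ]; trivial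
    induction h using Submonoid.closure_induction_right with
    | one => simp
    | mul_right σ _ τ hτ ih =>
      obtain ⟨i, rfl⟩ := hτ
      have h := prod_ofFn_swap_succ (x ∘ σ) (fun a b hab => hx _ _ (σ.injective.ne hab)) i
      rw [Equiv.Perm.coe_mul, ← Function.comp_assoc, h, ih, Equiv.Perm.sign_mul,
        Equiv.Perm.sign_swap (Fin.castSucc_lt_succ (i := i)).ne]
      simp

/-! ## Traces of Clifford elements -/

theorem gamma_mul_of_ne {a b : Fin 11} (h : a ≠ b) : gamma a * gamma b = -(gamma b * gamma a) := by
  have := gamma_clifford a b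
  rw [if_neg h, zero_smul] at this
  exact eq_neg_of_add_eq_zero_left this

/-- Distinct Γ's anticommute, so all k! signed summands coincide and cancel the prefactor. -/
theorem cliff_eq_prod {k : ℕ} (t : Fin k → Fin 11) (ht : Function.Injective t) :
    cliff t = (List.ofFn fun i => gamma (t i)).prod := by
  have h : ∀ σ : Equiv.Perm (Fin k), ((Equiv.Perm.sign σ : ℤ) : ℝ) •
      (List.ofFn fun i => gamma (t (σ i))).prod = (List.ofFn fun i => gamma (t i)).prod := by
    intro σ
    have := prod_ofFn_comp_perm (fun i => gamma (t i))
      (fun i j hij => gamma_mul_of_ne (ht.ne hij)) σ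
    simp only [Function.comp_def] at this
    rw [this, smul_smul, sign_mul_self, one_smul]
  rw [cliff, Finset.sum_congr rfl fun σ _ => h σ]
  simp only [Finset.sum_const, Finset.card_univ, Fintype.card_perm, Fintype.card_fin]
  rw [← Nat.cast_smul_eq_nsmul ℝ, smul_smul, inv_mul_cancel₀ (by positivity), one_smul]

/-- Swapping two equal indices leaves `t` fixed but changes the sign. -/
theorem cliff_eq_zero {k : ℕ} (t : Fin k → Fin 11) (ht : ¬ Function.Injective t) :
    cliff t = 0 := by
  simp only [Function.Injective, not_forall] at ht
  obtain ⟨i, j, h, hij⟩ := ht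
  have h1 := cliff_comp t (Equiv.swap i j)
  have h2 : t ∘ Equiv.swap i j = t := by
    funext k
    rcases eq_or_ne k i with rfl | hi
    · simp [h]
    · rcases eq_or_ne k j with rfl | hj
      · simp [h]
      · simp [Equiv.swap_apply_of_ne_of_ne hi hj]
  rw [h2, Equiv.Perm.sign_swap hij] at h1
  simp only [Units.val_neg, Units.val_one, Int.cast_neg, Int.cast_one, neg_smul, one_smul] at h1
  ext α β
  have h3 := congrFun (congrFun h1 α) β
  rw [Matrix.neg_apply] at h3
  rw [Matrix.zero_apply]
  linarith

/-- The sign for commuting `Γ_c` past `Γ_{t_1} ⋯ Γ_{t_k}`. -/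
def passCliff (c : Fin 11) {k : ℕ} (t : Fin k → Fin 11) : ℝ := ∏ i, if t i = c then 1 else -1

theorem gamma_mul_prod (c : Fin 11) {k : ℕ} (t : Fin k → Fin 11) :
    gamma c * (List.ofFn fun i => gamma (t i)).prod
      = passCliff c t • ((List.ofFn fun i => gamma (t i)).prod * gamma c) := by
  induction k with
  | zero => simp [passCliff]
  | succ k ih =>
    have h : gamma c * gamma (t 0) = (if t 0 = c then (1 : ℝ) else -1) • (gamma (t 0) * gamma c) := by
      split_ifs with h
      · simp [h]
      · simp [gamma_mul_of_ne (Ne.symm h)]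
    simp only [List.ofFn_succ, List.prod_cons, passCliff, Fin.prod_univ_succ]
    rw [← mul_assoc, h, smul_mul_assoc, mul_assoc, ih fun i => t i.succ]
    simp only [passCliff, mul_smul_comm, smul_smul, mul_assoc]

theorem gamma_mul_cliff (c : Fin 11) {k : ℕ} (t : Fin k → Fin 11) :
    gamma c * cliff t = passCliff c t • (cliff t * gamma c) := by
  by_cases ht : Function.Injective t
  · rw [cliff_eq_prod t ht, gamma_mul_prod]
  · simp [cliff_eq_zero t ht]

theorem gamma_transpose (a : Fin 11) : (gamma a).transpose = eta a • gamma a := by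
  fin_cases a <;>
    simp [gamma, eta, kron5_transpose, s1_t, s3_t, ee_t, kron5_neg1, kron5_neg2, kron5_neg3,
      kron5_neg4, kron5_neg5]

theorem passCliff_mul_self (c : Fin 11) {k : ℕ} (t : Fin k → Fin 11) :
    passCliff c t * passCliff c t = 1 := by
  rw [passCliff, ← Finset.prod_mul_distrib]
  refine Finset.prod_eq_one fun i _ => ?_
  split_ifs <;> simp

theorem eta_mul_self (a : Fin 11) : eta a * eta a = 1 := by
  unfold eta; split_ifs <;> simp

theorem transpose_cliff_mul_gamma (c : Fin 11) {k : ℕ} (t : Fin k → Fin 11) :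
    (cliff t).transpose * gamma c = passCliff c t • (gamma c * (cliff t).transpose) := by
  have h := congrArg Matrix.transpose (gamma_mul_cliff c t)
  rw [Matrix.transpose_smul, Matrix.transpose_mul, Matrix.transpose_mul, gamma_transpose,
    Matrix.mul_smul, Matrix.smul_mul, smul_comm] at h
  have h2 := congrArg (eta c • ·) h
  simp only [smul_smul] at h2
  rw [← mul_assoc, eta_mul_self, one_mul, one_smul] at h2
  exact h2

/-- Moving Γ_c around the trace by cyclicity and back through both factors costs a sign -1, while
Γ_c² is a nonzero scalar. -/
theorem trace_cliff_eq_zero (c : Fin 11) {k m : ℕ} (s : Fin k → Fin 11) (t : Fin m → Fin 11)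
    (h : passCliff c s * passCliff c t = -1) :
    ((cliff s).transpose * cliff t).trace = 0 := by
  have h1 : ((cliff s).transpose * cliff t * (gamma c * gamma c)).trace
      = -((cliff s).transpose * cliff t * (gamma c * gamma c)).trace := by
    calc ((cliff s).transpose * cliff t * (gamma c * gamma c)).trace
        = (gamma c * ((cliff s).transpose * (cliff t * gamma c))).trace := by
          rw [← mul_assoc, Matrix.trace_mul_comm]; simp only [mul_assoc]
      _ = passCliff c s * ((cliff s).transpose * (gamma c * cliff t) * gamma c).trace := by
          rw [← mul_assoc, ← mul_assoc (cliff s).transpose, transpose_cliff_mul_gamma]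
          simp only [Matrix.smul_mul, Matrix.trace_smul, smul_eq_mul]
          rw [← mul_assoc (passCliff c s), passCliff_mul_self, one_mul]
          simp only [mul_assoc]
      _ = -((cliff s).transpose * cliff t * (gamma c * gamma c)).trace := by
          rw [gamma_mul_cliff]
          simp only [Matrix.smul_mul, Matrix.mul_smul, Matrix.trace_smul, smul_eq_mul, mul_assoc]
          rw [← mul_assoc, h, neg_one_mul]
  rw [gamma_sq, Matrix.mul_smul, mul_one, Matrix.trace_smul, smul_eq_mul] at h1
  have h2 : eta c ≠ 0 := fun h0 => by simpa [h0] using eta_mul_self c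
  have h3 : eta c * ((cliff s).transpose * cliff t).trace = 0 := by linarith
  exact (mul_eq_zero.mp h3).resolve_left h2

theorem passCliff_of_mem {c : Fin 11} {k : ℕ} {t : Fin k → Fin 11} (ht : Function.Injective t)
    (h : c ∈ Set.range t) : passCliff c t = (-1) ^ (k + 1) := by
  obtain ⟨i, rfl⟩ := h
  rw [passCliff, ← Finset.mul_prod_erase _ _ (Finset.mem_univ i), if_pos rfl, one_mul,
    Finset.prod_congr rfl fun j hj => if_neg (ht.ne (Finset.ne_of_mem_erase hj)),
    Finset.prod_const, Finset.card_erase_of_mem (Finset.mem_univ i), Finset.card_fin]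
  cases k with
  | zero => exact i.elim0
  | succ k => simp [pow_succ]

theorem passCliff_of_notMem {c : Fin 11} {k : ℕ} {t : Fin k → Fin 11}
    (h : c ∉ Set.range t) : passCliff c t = (-1) ^ k := by
  rw [passCliff, Finset.prod_congr rfl fun j _ => if_neg fun hj => h ⟨j, hj⟩]
  simp

/-- Clifford elements with few, different indices are trace-orthogonal. -/
theorem range_eq_of_trace_ne_zero {k m : ℕ} {s : Fin k → Fin 11} {t : Fin m → Fin 11}
    (hs : Function.Injective s) (ht : Function.Injective t) (hkm : k + m < 11)
    (h : ((cliff s).transpose * cliff t).trace ≠ 0) : Set.range s = Set.range t := by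
  have key : ∀ c, passCliff c s * passCliff c t ≠ -1 :=
    fun c hc => h (trace_cliff_eq_zero c s t hc)
  rcases Nat.even_or_odd (k + m) with hp | hp
  -- For k + m even, an index lying in exactly one of the two ranges gives the sign -1.
  · have e1 : (-1 : ℝ) ^ (k + 1) * (-1) ^ m = -1 := by
      rw [← pow_add, add_right_comm, pow_succ, hp.neg_one_pow, one_mul]
    have e2 : (-1 : ℝ) ^ k * (-1) ^ (m + 1) = -1 := by
      rw [← pow_add, ← add_assoc, pow_succ, hp.neg_one_pow, one_mul]
    ext c
    constructor
    · intro hc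
      by_contra hc'
      exact key c (by rw [passCliff_of_mem hs hc, passCliff_of_notMem hc', e1])
    · intro hc
      by_contra hc'
      exact key c (by rw [passCliff_of_mem ht hc, passCliff_of_notMem hc', e2])
  -- For k + m odd, an index missed by both ranges gives the sign -1. It exists since k + m < 11; at
  -- k + m = 11 complementary elements do pair, because the volume element is 1.
  · exfalso
    have hcard : (Finset.image s Finset.univ ∪ Finset.image t Finset.univ).card
        < (Finset.univ : Finset (Fin 11)).card := by
      refine lt_of_le_of_lt ((Finset.card_union_le _ _).trans
        (add_le_add Finset.card_image_le Finset.card_image_le)) ?_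
      simpa using hkm
    obtain ⟨c, -, hc⟩ := Finset.exists_mem_notMem_of_card_lt_card hcard
    simp only [Finset.mem_union, Finset.mem_image, Finset.mem_univ, true_and, not_or] at hc
    refine key c ?_
    rw [passCliff_of_notMem hc.1, passCliff_of_notMem hc.2, ← pow_add, hp.neg_one_pow]

theorem etaT_eq_one {k : ℕ} {s : Fin k → Fin 11} (hs : ∀ i, s i ≠ 0) : etaT s = 1 :=
  Finset.prod_eq_one fun i _ => by simp [eta, hs i]

/-- Spatial Γ's are symmetric and square to 1, hence orthogonal. This is why all index sets used
below avoid 0. -/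
theorem gamma_list_orthogonal (l : List (Fin 11)) (hl : ∀ a ∈ l, a ≠ 0) :
    (l.map gamma).prod.transpose * (l.map gamma).prod = 1 := by
  induction l with
  | nil => simp
  | cons a l ih =>
    have ha : eta a = 1 := by simp [eta, hl a (by simp)]
    rw [List.map_cons, List.prod_cons, Matrix.transpose_mul, mul_assoc,
      ← mul_assoc (gamma a).transpose, gamma_transpose, ha, one_smul, gamma_sq, ha, one_smul,
      one_mul, ih fun b hb => hl b (List.mem_cons_of_mem a hb)]

theorem trace_cliff_self {k : ℕ} {s : Fin k → Fin 11} (hs : Function.Injective s)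
    (h0 : ∀ i, s i ≠ 0) : ((cliff s).transpose * cliff s).trace = 32 := by
  have h := gamma_list_orthogonal (List.ofFn s) (by simpa using h0)
  rw [List.map_ofFn] at h
  rw [cliff_eq_prod s hs]
  change ((List.ofFn (gamma ∘ s)).prod.transpose * (List.ofFn (gamma ∘ s)).prod).trace = 32
  rw [h, Matrix.trace_one]
  norm_num

theorem bosForm_ofFn {p : Rank} (s t : Fin p.1 → Fin 11) :
    bosForm (List.ofFn s) (.e p t)
      = ∑ σ : Equiv.Perm (Fin p.1), ((Equiv.Perm.sign σ : ℤ) : ℝ) * if t = s ∘ σ then 1 else 0 := by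
  rw [bosForm, ← Equiv.sum_comp (Equiv.inv (Equiv.Perm (Fin p.1)))]
  refine Finset.sum_congr rfl fun σ _ => ?_
  have h : List.ofFn (t ∘ ((Equiv.inv (Equiv.Perm (Fin p.1))) σ)) = List.ofFn s ↔ t = s ∘ σ := by
    rw [List.ofFn_injective.eq_iff]
    constructor
    · rintro rfl
      funext i; simp
    · rintro rfl
      funext i; simp
  simp only [h]
  simp

theorem bosForm_self {p : Rank} {s : Fin p.1 → Fin 11} (hs : Function.Injective s) :
    bosForm (List.ofFn s) (.e p s) = 1 := by
  rw [bosForm_ofFn, Finset.sum_eq_single 1]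
  · simp
  · intro σ _ hσ
    rw [if_neg, mul_zero]
    intro h
    refine hσ (Equiv.ext fun i => hs ?_)
    exact (congrFun h i).symm
  · simp

/-- The trace pairing with a Clifford element is the dual covector. -/
theorem trace_cliff {q : Rank} {s : Fin q.1 → Fin 11} (hs : Function.Injective s)
    (h0 : ∀ i, s i ≠ 0) (p : Rank) (hpq : p.1 + q.1 < 11) (t : Fin p.1 → Fin 11) :
    ((cliff s).transpose * cliff t).trace = 32 * bosForm (List.ofFn s) (.e p t) := by
  by_cases hp : p = q
  · subst hp
    by_cases hσ : ∃ σ : Equiv.Perm (Fin p.1), t = s ∘ σ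
    · obtain ⟨σ, rfl⟩ := hσ
      have hb := (bosCov (List.ofFn s)).skew p s σ
      rw [bosCov_val, bosForm_self hs] at hb
      rw [cliff_comp, Matrix.mul_smul, Matrix.trace_smul, trace_cliff_self hs h0, hb, smul_eq_mul]
      ring
    · have hb : bosForm (List.ofFn s) (.e p t) = 0 := by
        rw [bosForm_ofFn]
        exact Finset.sum_eq_zero fun σ _ => by rw [if_neg fun h => hσ ⟨σ, h⟩, mul_zero]
      rw [hb, mul_zero]
      by_contra h
      have ht : Function.Injective t := by
        by_contra ht
        rw [cliff_eq_zero t ht] at h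
        simp at h
      have hr := range_eq_of_trace_ne_zero hs ht hpq h
      refine hσ ⟨(Equiv.ofInjective t ht).trans ((Equiv.setCongr hr.symm).trans
        (Equiv.ofInjective s hs).symm), ?_⟩
      funext i
      simp [Equiv.apply_ofInjective_symm]
  · have hne : p.1 ≠ q.1 := fun h => hp (Subtype.ext h)
    rw [bosForm_eq_zero _ _ _ (by simpa using hne), mul_zero]
    by_contra h
    have ht : Function.Injective t := by
      by_contra ht
      rw [cliff_eq_zero t ht] at h
      simp at h
    have hr := range_eq_of_trace_ne_zero hs ht (by omega) h
    have h1 := Set.ncard_range_of_injective hs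
    have h2 := Set.ncard_range_of_injective ht
    rw [hr, h2] at h1
    simp at h1
    exact hne h1

/-! ## Contractions and the differential -/

theorem d_gen_mul (s : ℝ) (x : Gen) (w : CE) :
    d s (gen x * w) = dGen s x * w - gen x * d s w := by
  rw [d_mul, d_gen, degSign_gen, neg_mul, sub_eq_add_neg]

theorem d_one (s : ℝ) : d s 1 = 0 := by simp [d]

theorem contr_bil_psi_mul (v : Covector 0) (M : SpinorMat) (w : CE) :
    contr v (bil psi M psi * w) = bil psi M psi * contr v w := by
  have h : ∀ α, v.val (.psi α) = 0 := fun α => v.supp _ (by simp [Gen.superDeg])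
  simp only [bil, Finset.sum_mul, map_sum, smul_mul_assoc, map_smul, mul_assoc]
  simp [psi, contr_gen_mul, h, passSign_zero]

theorem contr_psi_mul_e_mul (v : Covector 0) (β : SpinorIdx) (p : Rank) (t : Fin p.1 → Fin 11)
    (w : CE) : contr v (psi β * gen (.e p t) * w)
      = psi β * gen (.e p t) * contr v w - v.val (.e p t) • (psi β * w) := by
  have h : ∀ α, v.val (.psi α) = 0 := fun α => v.supp _ (by simp [Gen.superDeg])
  rw [mul_assoc, psi, contr_gen_mul, contr_gen_mul, h, passSign_zero, passSign_zero]
  simp only [zero_smul, zero_add, mul_add, smul_add, mul_smul_comm, smul_smul, mul_assoc]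
  simp only [neg_smul, one_smul, mul_neg, mul_one, neg_mul, one_mul, neg_neg]
  abel

/-- This is where s = -1 enters: `delta (-1) = 0` removes the only occurrence of e^a in the
differentials of the generators. -/
theorem contr_dGen_mul (a : Fin 11) (x : Gen) (w : CE) :
    contr (bosCov [a]) (dGen (-1) x * w) = dGen (-1) x * contr (bosCov [a]) w := by
  cases x with
  | e p t => simp only [dGen, smul_mul_assoc, map_smul, contr_bil_psi_mul]
  | psi α => simp [dGen]
  | phi α =>
    have h2 : ∀ b c, (bosCov [a]).val (.e ⟨2, by decide⟩ ![b, c]) = 0 :=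
      fun b c => by rw [bosCov_val]; exact bosForm_eq_zero _ _ _ (by simp)
    have h5 : ∀ t, (bosCov [a]).val (.e ⟨5, by decide⟩ t) = 0 :=
      fun t => by rw [bosCov_val]; exact bosForm_eq_zero _ _ _ (by simp)
    have h0 : delta (-1) = 0 := by simp [delta]
    simp only [dGen, h0, zero_smul, zero_add, add_mul, map_add, smul_mul_assoc, map_smul,
      Finset.sum_mul, map_sum, e2, e5, contr_psi_mul_e_mul, h2, h5, sub_zero]

/-- At `s = -1` the contractions with the duals of the `e^a` anticommute with the differential. -/
theorem contr_d (a : Fin 11) (w : CE) :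
    contr (bosCov [a]) (d (-1) w) = -d (-1) (contr (bosCov [a]) w) := by
  refine linearMap_eq_of_gen_mul (contr (bosCov [a]) ∘ₗ d (-1)) (-(d (-1) ∘ₗ contr (bosCov [a])))
    ?_ ?_ w
  · simp [d_one, contr_one]
  · intro x w h
    simp only [LinearMap.comp_apply, LinearMap.neg_apply] at h ⊢
    simp only [d_gen_mul, map_sub, contr_dGen_mul, contr_gen_mul, map_add, map_smul, h,
      passSign_zero]
    simp only [mul_neg, neg_smul, one_smul, smul_neg]
    abel

/-! ## Pairings of three-forms `ψ ψ e` with a bilinear form and a covector -/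

/-- The second order contraction `N^{αβ} ∂_α ∂_β` with the duals of the `ψ^α`. -/
def quadContr (N : SpinorMat) : CE →ₗ[ℝ] CE :=
  ∑ α, ∑ β, N α β • (contr (psiCov α) ∘ₗ contr (psiCov β))

theorem quadContr_apply (N : SpinorMat) (w : CE) :
    quadContr N w = ∑ α, ∑ β, N α β • contr (psiCov α) (contr (psiCov β) w) := by
  simp [quadContr]

/-- The functional reading off the `ψ ψ e`-part of a three-form. -/
def pairing (N : SpinorMat) (l : List (Fin 11)) : CE →ₗ[ℝ] ℝ :=
  counit.toLinearMap ∘ₗ quadContr N ∘ₗ contr (bosCov l)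

theorem pairing_apply (N : SpinorMat) (l : List (Fin 11)) (w : CE) :
    pairing N l w = counit (quadContr N (contr (bosCov l) w)) := rfl

/-- The values of `counit ∘ quadContr N` on products of two generators. -/
def quadVal (N : SpinorMat) : Gen → Gen → ℝ
  | .psi α, .psi β => N α β + N β α
  | _, _ => 0

theorem counit_quadContr (N : SpinorMat) (x y : Gen) :
    counit (quadContr N (gen x * gen y)) = quadVal N x y := by
  simp only [quadContr_apply, contr_gen_mul, contr_gen, map_add, map_smul, smul_eq_mul, map_sum,
    mul_smul_comm, mul_one, map_one]
  cases x <;> cases y <;>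
    simp [quadVal, psiCov_e, psiCov_psi, psiCov_phi, passSign_one_psi, mul_add,
      Finset.sum_add_distrib, add_comm]

theorem pairing_gen (N : SpinorMat) (l : List (Fin 11)) (x y z : Gen) :
    pairing N l (gen x * gen y * gen z)
      = bosForm l x * quadVal N y z - bosForm l y * quadVal N x z + bosForm l z * quadVal N x y := by
  rw [pairing_apply, mul_assoc]
  simp only [contr_gen_mul, contr_gen, map_add, map_smul, smul_eq_mul, mul_smul_comm, mul_one,
    counit_quadContr, passSign_zero, bosCov_val, smul_add, mul_add]
  ring

theorem quadVal_e_left (N : SpinorMat) (p : Rank) (t : Fin p.1 → Fin 11) (x : Gen) :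
    quadVal N (.e p t) x = 0 := rfl
theorem quadVal_e_right (N : SpinorMat) (p : Rank) (t : Fin p.1 → Fin 11) (x : Gen) :
    quadVal N x (.e p t) = 0 := by cases x <;> rfl
theorem quadVal_psi (N : SpinorMat) (α β : SpinorIdx) :
    quadVal N (.psi α) (.psi β) = N α β + N β α := rfl

theorem sum_mul_quadVal {N : SpinorMat} (hN : N.transpose = N) (M : SpinorMat) :
    ∑ α, ∑ γ, M α γ * quadVal N (.psi α) (.psi γ) = 2 * (N.transpose * M).trace := by
  have h : ∀ α γ, N γ α = N α γ := fun α γ => congrFun (congrFun hN α) γ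
  simp only [quadVal_psi, h, Matrix.trace, Matrix.diag_apply, Matrix.mul_apply,
    Matrix.transpose_apply, Finset.mul_sum]
  rw [Finset.sum_comm]
  refine Finset.sum_congr rfl fun α _ => Finset.sum_congr rfl fun γ _ => ?_
  rw [h]
  ring

theorem spinorMetric_transpose_mul : spinorMetric.transpose * spinorMetric = 1 := by
  rw [spinorMetric_skew, neg_mul, spinorMetric_sq, neg_neg]

/-- The spinor metric is an orthogonal matrix and drops out, leaving the trace form on Clifford
elements. The factor 2 comes from differentiating the symmetric quadratic form in ψ twice. -/
theorem sum_spinorMetric_mul_quadVal {S : SpinorMat}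
    (hS : (spinorMetric * S).transpose = spinorMetric * S) (M : SpinorMat) :
    ∑ α, ∑ γ, (spinorMetric * M) α γ * quadVal (spinorMetric * S) (.psi α) (.psi γ)
      = 2 * (S.transpose * M).trace := by
  rw [sum_mul_quadVal hS, Matrix.transpose_mul, mul_assoc, ← mul_assoc spinorMetric.transpose,
    spinorMetric_transpose_mul, one_mul]

theorem pairing_bil_psi_mul {S : SpinorMat}
    (hS : (spinorMetric * S).transpose = spinorMetric * S) (l : List (Fin 11)) (M : SpinorMat)
    (x : Gen) : pairing (spinorMetric * S) l (bil psi M psi * gen x)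
      = 2 * (S.transpose * M).trace * bosForm l x := by
  rw [← sum_spinorMetric_mul_quadVal hS, Finset.sum_mul, bil, Finset.sum_mul, map_sum]
  refine Finset.sum_congr rfl fun α _ => ?_
  rw [Finset.sum_mul, Finset.sum_mul, map_sum]
  refine Finset.sum_congr rfl fun γ _ => ?_
  rw [smul_mul_assoc, map_smul, psi, psi, pairing_gen, bosForm_psi, bosForm_psi, smul_eq_mul]
  ring

/-- The sum against a dual covector picks out one component. -/
theorem sum_bosForm_smul {M : Type} [AddCommGroup M] [Module ℝ M] (p : Rank)
    (s : Fin p.1 → Fin 11) (F : (Fin p.1 → Fin 11) → M)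
    (hF : ∀ σ : Equiv.Perm (Fin p.1), F (s ∘ σ) = ((Equiv.Perm.sign σ : ℤ) : ℝ) • F s) :
    ∑ t, bosForm (List.ofFn s) (.e p t) • F t = (p.1.factorial : ℝ) • F s := by
  simp only [bosForm_ofFn, Finset.sum_smul]
  rw [Finset.sum_comm]
  have h : ∀ σ : Equiv.Perm (Fin p.1), ∑ t, ((((Equiv.Perm.sign σ : ℤ) : ℝ) *
      if t = s ∘ σ then 1 else 0) • F t) = F s := by
    intro σ
    rw [Finset.sum_eq_single (s ∘ σ)]
    · rw [if_pos rfl, mul_one, hF, smul_smul, sign_mul_self, one_smul]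
    · intro t _ ht
      rw [if_neg ht, mul_zero, zero_smul]
    · simp
  rw [Finset.sum_congr rfl fun σ _ => h σ]
  simp [Fintype.card_perm, ← Nat.cast_smul_eq_nsmul ℝ]

/-- The pairing of `(d x) y` for a bosonic generator `x`. -/
theorem pairing_dGen_e_mul {q : Rank} {s : Fin q.1 → Fin 11} (hs : Function.Injective s)
    (h0 : ∀ i, s i ≠ 0) (hq : q.1 ≠ 2)
    (hS : (spinorMetric * cliff s).transpose = spinorMetric * cliff s) (l : List (Fin 11))
    (p : Rank) (t : Fin p.1 → Fin 11) (x : Gen) :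
    pairing (spinorMetric * cliff s) l (dGen (-1) (.e p t) * gen x)
      = 64 * bosForm (List.ofFn s) (.e p t) * bosForm l x := by
  -- Ranks are at most 5, so the sum is at most 10, just below the range of Clifford duality.
  have hpq : p.1 + q.1 < 11 := by
    rcases p.2 with h | h | h <;> rcases q.2 with h' | h' | h' <;> omega
  rw [dGen, smul_mul_assoc, map_smul, pairing_bil_psi_mul hS, cliffUp, Matrix.mul_smul,
    Matrix.trace_smul, trace_cliff hs h0 p hpq t, smul_eq_mul, smul_eq_mul]
  -- If the component is nonzero, `t` permutes `s`: its indices are spatial, so raising them costs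
  -- no sign, and its rank is not 2, so `bosSign` is 1. The 64 is 2 · 32.
  by_cases h : bosForm (List.ofFn s) (.e p t) = 0
  · simp [h]
  · have hp : p = q := by
      by_contra hp
      exact h (bosForm_eq_zero _ _ _ (by simpa using fun h => hp (Subtype.ext h)))
    subst hp
    have hσ : ∃ σ : Equiv.Perm (Fin p.1), t = s ∘ σ := by
      by_contra hσ
      refine h ?_
      rw [bosForm_ofFn]
      exact Finset.sum_eq_zero fun σ _ => by rw [if_neg fun h => hσ ⟨σ, h⟩, mul_zero]
    obtain ⟨σ, rfl⟩ := hσ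
    rw [etaT_comp, etaT_eq_one h0, bosSign, if_neg hq]
    ring

/-- Only the five-index term of dφ is seen. The factor 240 is 2 · 5!, with 5! from the reorderings
of `B` and 2 from the symmetry of `N`; the minus sign comes from contracting past the leading ψ. -/
theorem pairing_dGen_phi_mul_psi (B : Fin 5 → Fin 11) (N : SpinorMat) (hN : N.transpose = N)
    (α β : SpinorIdx) :
    pairing N (List.ofFn B) (dGen (-1) (.phi α) * gen (.psi β))
      = -(240 * gamma2 (-1)) * (cliff B * N) α β := by
  have hN' : ∀ α γ, N γ α = N α γ := fun α γ => congrFun (congrFun hN α) γ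
  have h0 : delta (-1) = 0 := by simp [delta]
  have h2 : ∀ b c, bosForm (List.ofFn B) (.e ⟨2, by decide⟩ ![b, c]) = 0 :=
      fun b c => bosForm_eq_zero _ _ _ (by simp)
  have hsum := sum_bosForm_smul ⟨5, by decide⟩ B (fun t => (cliff t * N) α β) (by
    intro σ
    simp only [cliff_comp, Matrix.smul_mul, Matrix.smul_apply])
  simp only [dGen, h0, zero_smul, zero_add, add_mul, map_add, smul_mul_assoc, map_smul,
      Finset.sum_mul, map_sum, e2, e5, psi, pairing_gen, h2, bosForm_psi, smul_eq_mul, quadVal_psi,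
      quadVal_e_left, quadVal_e_right, hN']
  simp only [zero_mul, mul_zero, sub_zero, zero_sub, add_zero, Finset.sum_const_zero, zero_add]
  have h3 : ∀ t : Fin 5 → Fin 11, ∑ γ, cliff t α γ *
      -(bosForm (List.ofFn B) (.e ⟨5, by decide⟩ t) * (N β γ + N β γ))
      = -2 * (bosForm (List.ofFn B) (.e ⟨5, by decide⟩ t) • (cliff t * N) α β) := by
    intro t
    rw [Matrix.mul_apply, smul_eq_mul, Finset.mul_sum, Finset.mul_sum]
    refine Finset.sum_congr rfl fun γ _ => ?_
    rw [hN' γ β]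
    ring
  rw [Finset.sum_congr rfl fun t _ => h3 t, ← Finset.mul_sum]
  erw [hsum]
  norm_num [Nat.factorial]
  ring

theorem pairing_dGen_phi_mul_psi_singleton (a : Fin 11) (N : SpinorMat) (α β : SpinorIdx) :
    pairing N [a] (dGen (-1) (.phi α) * gen (.psi β)) = 0 := by
  have h0 : delta (-1) = 0 := by simp [delta]
  have h2 : ∀ b c, bosForm [a] (.e ⟨2, by decide⟩ ![b, c]) = 0 :=
      fun b c => bosForm_eq_zero _ _ _ (by simp)
  have h5 : ∀ t, bosForm [a] (.e ⟨5, by decide⟩ t) = 0 :=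
      fun t => bosForm_eq_zero _ _ _ (by simp)
  simp [dGen, h0, add_mul, Finset.sum_mul, e2, e5, psi, pairing_gen, h2, h5, bosForm_psi]

/-- Since dφ is linear in ψ, a ψψe component requires the other factor to be a ψ. -/
theorem pairing_dGen_phi_mul (l : List (Fin 11)) (N : SpinorMat) (α : SpinorIdx) (x : Gen)
    (hx : ∀ β, x ≠ .psi β) :
    pairing N l (dGen (-1) (.phi α) * gen x) = 0 := by
  have hq : ∀ γ, quadVal N (.psi γ) x = 0 := by
    intro γ
    cases x with
    | psi β => exact absurd rfl (hx β)
    | e p t => rfl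
    | phi β => rfl
  simp [dGen, add_mul, Finset.sum_mul, e1, e2, e5, psi, pairing_gen, bosForm_psi, hq,
    quadVal_e_left, quadVal_e_right]

/-! ## The obstruction functional -/

/-- The sets are chosen so that A and 5, like B and C, have symmetric difference 1234; both Clifford
products then reduce to ±Γ_{1234}. Exchanging 1, 2 with 3, 4 swaps B and C. -/
def idxA : Fin 5 → Fin 11 := ![1, 2, 3, 4, 5]
def idxB : Fin 5 → Fin 11 := ![1, 2, 5, 6, 7]
def idxC : Fin 5 → Fin 11 := ![3, 4, 5, 6, 7]
def idx5 : Fin 1 → Fin 11 := ![5]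

theorem idxA_injective : Function.Injective idxA := by decide
theorem idxB_injective : Function.Injective idxB := by decide
theorem idxC_injective : Function.Injective idxC := by decide
theorem idx5_injective : Function.Injective idx5 := by decide

theorem cliff_idxA : cliff idxA = kron5 s1 ee 1 1 ee := by
  rw [cliff_eq_prod _ idxA_injective]
  simp [idxA, List.ofFn_succ, gamma, kron5_mul, s1_s1, ee_ee, s1_s3, kron5_neg2, kron5_neg3,
    kron5_neg4, kron5_neg5]

theorem cliff_idxB : cliff idxB = kron5 s1 ee s1 s1 ee := by
  rw [cliff_eq_prod _ idxB_injective]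
  simp [idxB, List.ofFn_succ, gamma, kron5_mul, s1_s1, ee_ee, s1_s3, s1_ee, ee_s3, kron5_neg2,
    kron5_neg3, kron5_neg4, kron5_neg5]

theorem cliff_idxC : cliff idxC = -kron5 s1 ee ee s3 1 := by
  rw [cliff_eq_prod _ idxC_injective]
  simp [idxC, List.ofFn_succ, gamma, kron5_mul, s1_s1, ee_ee, s1_s3, kron5_neg2, kron5_neg3,
    kron5_neg4, kron5_neg5]

theorem cliff_idx5 : cliff idx5 = kron5 s1 ee s3 ee 1 := by
  rw [cliff_eq_prod _ idx5_injective]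
  simp [idx5, List.ofFn_succ, gamma]

/-- The ψ commute with one another, so only symmetric matrices give nonzero quadratic forms in ψ. -/
theorem idxA_symm :
    (spinorMetric * cliff idxA).transpose = spinorMetric * cliff idxA := by
  simp [cliff_idxA, spinorMetric, gamma, kron5_mul, kron5_transpose, s3_t, ee_t, ee_s1,
    kron5_neg2, kron5_neg5]

theorem idxC_symm :
    (spinorMetric * cliff idxC).transpose = spinorMetric * cliff idxC := by
  simp [cliff_idxC, spinorMetric, gamma, kron5_mul, kron5_transpose, s3_t, ee_t, ee_s1,
    kron5_neg2, kron5_neg3]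

theorem idx5_symm :
    (spinorMetric * cliff idx5).transpose = spinorMetric * cliff idx5 := by
  simp [cliff_idx5, spinorMetric, gamma, kron5_mul, kron5_transpose, s3_t, ee_t, ee_s1,
    kron5_neg2, kron5_neg4]

/-- The gravitino contributions for the two pairs of complementary indices cancel. -/
theorem cliff_cancel : cliff idxA * (spinorMetric * cliff idx5)
    + cliff idxB * (spinorMetric * cliff idxC) = 0 := by
  simp [cliff_idxA, cliff_idxB, cliff_idxC, cliff_idx5, spinorMetric, gamma, kron5_mul, ee_ee,
    ee_s1, s1_ee, s1_s3, kron5_neg1, kron5_neg2, kron5_neg3, kron5_neg4]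

/-- The functional on `3`-forms detecting the obstruction. -/
def obstruction : CE →ₗ[ℝ] ℝ :=
  pairing (spinorMetric * cliff idxA) (List.ofFn idx5)
    + pairing (spinorMetric * cliff idx5) (List.ofFn idxA)
    + pairing (spinorMetric * cliff idxC) (List.ofFn idxB)

/-- The coefficient of `e^{12567} e^{34567}`. -/
def coeffBC : CE →ₗ[ℝ] ℝ :=
  counit.toLinearMap ∘ₗ contr (bosCov (List.ofFn idxC)) ∘ₗ contr (bosCov (List.ofFn idxB))

theorem coeffBC_gen (x y : Gen) : coeffBC (gen x * gen y)
    = bosForm (List.ofFn idxB) x * bosForm (List.ofFn idxC) y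
      - bosForm (List.ofFn idxB) y * bosForm (List.ofFn idxC) x := by
  simp only [coeffBC, LinearMap.comp_apply, AlgHom.toLinearMap_apply, contr_gen_mul, contr_gen,
    map_add, map_smul, map_one, smul_eq_mul, mul_one, mul_smul_comm, passSign_zero, bosCov_val]
  ring

/-- The first two terms are together symmetric under exchange of the generators and cancel in the
differential of a bosonic product; the third is not, which is how e^B e^C is detected. -/
theorem obstruction_dGen_e_mul (p : Rank) (t : Fin p.1 → Fin 11) (x : Gen) :
    obstruction (dGen (-1) (.e p t) * gen x)
      = 64 * (bosForm (List.ofFn idxA) (.e p t) * bosForm (List.ofFn idx5) x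
        + bosForm (List.ofFn idx5) (.e p t) * bosForm (List.ofFn idxA) x
        + bosForm (List.ofFn idxC) (.e p t) * bosForm (List.ofFn idxB) x) := by
  have hA := pairing_dGen_e_mul (q := ⟨5, by decide⟩) idxA_injective (by decide) (by decide)
    idxA_symm (List.ofFn idx5) p t x
  have h5 := pairing_dGen_e_mul (q := ⟨1, by decide⟩) idx5_injective (by decide) (by decide)
    idx5_symm (List.ofFn idxA) p t x
  have hC := pairing_dGen_e_mul (q := ⟨5, by decide⟩) idxC_injective (by decide) (by decide)
    idxC_symm (List.ofFn idxB) p t x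
  simp only [obstruction, LinearMap.add_apply, hA, h5, hC]
  ring

theorem obstruction_dGen_phi_mul (α : SpinorIdx) (x : Gen) :
    obstruction (dGen (-1) (.phi α) * gen x) = 0 := by
  by_cases hx : ∃ β, x = .psi β
  · obtain ⟨β, rfl⟩ := hx
    have h5 : List.ofFn idx5 = [5] := rfl
    simp only [obstruction, LinearMap.add_apply, h5, pairing_dGen_phi_mul_psi_singleton,
      pairing_dGen_phi_mul_psi idxA _ idx5_symm, pairing_dGen_phi_mul_psi idxB _ idxC_symm]
    have h := congrFun (congrFun cliff_cancel α) β
    rw [Matrix.add_apply, Matrix.zero_apply] at h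
    rw [zero_add, ← mul_add, h, mul_zero]
  · push Not at hx
    simp [obstruction, pairing_dGen_phi_mul _ _ _ _ hx]

theorem d_gen_mul_gen (s : ℝ) (x y : Gen) :
    d s (gen x * gen y) = dGen s x * gen y + commSign x y • (dGen s y * gen x) := by
  rw [d_gen_mul, d_gen, dGen_mul_gen s y x, smul_smul, commSign_symm y x, mul_neg, commSign_sq,
    neg_one_smul, sub_eq_add_neg]

/-- The obstruction functional on exact forms. -/
theorem obstruction_d {w : CE} (hw : w ∈ forms 2) :
    obstruction (d (-1) w) = -64 * coeffBC w := by
  have h := eq_zero_of_forms_two (obstruction ∘ₗ d (-1) + (64 : ℝ) • coeffBC) ?_ hw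
  · simp only [LinearMap.add_apply, LinearMap.comp_apply, LinearMap.smul_apply, smul_eq_mul] at h
    linarith
  intro x y
  simp only [LinearMap.add_apply, LinearMap.comp_apply, LinearMap.smul_apply, smul_eq_mul,
    d_gen_mul_gen, map_add, map_smul, coeffBC_gen]
  -- Everything involving ψ or φ vanishes on both sides; `ring` settles the product of two bosonic
  -- generators.
  cases x <;> cases y <;>
    simp [obstruction_dGen_e_mul, obstruction_dGen_phi_mul, bosForm_psi, bosForm_phi, dGen.eq_2,
      commSign, Gen.superDeg]
  ring

/-! ## A permutation of the coordinates in `Spin(1,10)` -/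

/-- Equivariance of contraction: the hypothesis says that `w` is the pullback of `v`. The matrix `S`
is unconstrained because both covectors vanish on spinors. -/
theorem contr_act (S : SpinorMat) (L : Matrix (Fin 11) (Fin 11) ℝ) (v w : Covector 0)
    (h : ∀ (p : Rank) (t : Fin p.1 → Fin 11),
      ∑ u : Fin p.1 → Fin 11, (∏ i, L (t i) (u i)) * v.val (.e p u) = w.val (.e p t)) (x : CE) :
    contr v (act S L x) = act S L (contr w x) := by
  have hv : ∀ α, v.val (.psi α) = 0 := fun α => v.supp _ (by simp [Gen.superDeg])
  have hw : ∀ α, w.val (.psi α) = 0 := fun α => w.supp _ (by simp [Gen.superDeg])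
  have hv' : ∀ α, v.val (.phi α) = 0 := fun α => v.supp _ (by simp [Gen.superDeg])
  have hw' : ∀ α, w.val (.phi α) = 0 := fun α => w.supp _ (by simp [Gen.superDeg])
  refine linearMap_eq_of_gen_mul (contr v ∘ₗ (act S L).toLinearMap)
    ((act S L).toLinearMap ∘ₗ contr w) (by simp [contr_one]) ?_ x
  intro y x ih
  simp only [LinearMap.comp_apply, AlgHom.toLinearMap_apply] at ih ⊢
  have key : contr v (actGen S L y * act S L x)
      = w.val y • act S L x - actGen S L y * contr v (act S L x) := by
    cases y with
    | e p t =>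
      simp only [actGen, Finset.sum_mul, map_sum, smul_mul_assoc, map_smul, contr_gen_mul, ← h,
        passSign_zero, smul_add, Finset.sum_add_distrib, Finset.sum_smul, smul_smul, neg_one_smul,
        smul_neg, Finset.sum_neg_distrib, sub_eq_add_neg]
    | psi α =>
      simp [actGen, Finset.sum_mul, psi, contr_gen_mul, hv, hw, passSign_zero]
    | phi α =>
      simp [actGen, Finset.sum_mul, phi, contr_gen_mul, hv', hw', passSign_zero]
  rw [map_mul, act_gen, key, ih, contr_gen_mul, passSign_zero, neg_one_smul]
  simp [act_gen, sub_eq_add_neg]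

/-- The action of a permutation matrix on the dual covectors. -/
theorem contr_act_perm (S : SpinorMat) (π : Equiv.Perm (Fin 11)) (l : List (Fin 11)) (x : CE) :
    contr (bosCov l) (act S (Matrix.of fun a b => if π a = b then 1 else 0) x)
      = act S (Matrix.of fun a b => if π a = b then 1 else 0)
          (contr (bosCov (l.map π.symm)) x) := by
  refine contr_act _ _ _ _ (fun p t => ?_) x
  rw [Finset.sum_eq_single (π ∘ t)]
  · simp only [Matrix.of_apply, Function.comp_apply, if_true, Finset.prod_const_one, one_mul,
      bosCov_val, bosForm]
    refine Finset.sum_congr rfl fun σ _ => ?_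
    congr 1
    have : List.ofFn ((π ∘ t) ∘ σ) = l ↔ List.ofFn (t ∘ σ) = l.map π.symm := by
      rw [Function.comp_assoc, ← List.map_ofFn]
      constructor
      · rintro rfl
        simp [List.map_ofFn, Function.comp_def]
      · intro h
        simp [h]
    simp only [this]
  · intro u _ hu
    obtain ⟨i, hi⟩ := Function.ne_iff.mp hu
    rw [Finset.prod_eq_zero (Finset.mem_univ i), zero_mul]
    exact if_neg (Ne.symm hi)
  · simp

/-- The permutation exchanging `1, 2` with `3, 4`. -/
def swapPerm : Equiv.Perm (Fin 11) := Equiv.swap 1 3 * Equiv.swap 2 4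

/-- Reflections in `vec13` and `vec24` exchange 1 with 3 and 2 with 4. The scalings give norms 1/2
and 2, with product 1, and so avoid √2. -/
def vec13 : Fin 11 → ℝ := Pi.single 1 (1 / 2) - Pi.single 3 (1 / 2)
def vec24 : Fin 11 → ℝ := Pi.single 2 1 - Pi.single 4 1

theorem minkowski_apply (v : Fin 11 → ℝ) : minkowski v = ∑ a, eta a * (v a * v a) := by
  simp [minkowski, QuadraticMap.weightedSumSquares_apply]

theorem minkowski_polar (v w : Fin 11 → ℝ) :
    QuadraticMap.polar minkowski v w = 2 * ∑ a, eta a * (v a * w a) := by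
  simp only [QuadraticMap.polar, minkowski_apply, ← Finset.sum_sub_distrib, Finset.mul_sum]
  refine Finset.sum_congr rfl fun a _ => ?_
  simp only [Pi.add_apply]
  ring

theorem polar_vec13 (v : Fin 11 → ℝ) :
    QuadraticMap.polar minkowski vec13 v = v 1 - v 3 := by
  rw [minkowski_polar, Finset.sum_eq_add (1 : Fin 11) 3 (by decide)]
  · simp [vec13, eta]
    ring
  · rintro c - ⟨h1, h3⟩
    simp [vec13, h1, h3]
  · simp
  · simp

theorem polar_vec24 (v : Fin 11 → ℝ) :
    QuadraticMap.polar minkowski vec24 v = 2 * (v 2 - v 4) := by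
  rw [minkowski_polar, Finset.sum_eq_add (2 : Fin 11) 4 (by decide)]
  · simp [vec24, eta]
    ring
  · rintro c - ⟨h1, h3⟩
    simp [vec24, h1, h3]
  · simp
  · simp

theorem minkowski_vec13 : minkowski vec13 = 1 / 2 := by
  have h := QuadraticMap.polar_self minkowski vec13
  have h1 : vec13 1 = 1 / 2 := by simp [vec13]
  have h3 : vec13 3 = -(1 / 2) := by simp [vec13]
  rw [polar_vec13, h1, h3, nsmul_eq_mul] at h
  push_cast at h
  linarith

theorem minkowski_vec24 : minkowski vec24 = 2 := by
  have h := QuadraticMap.polar_self minkowski vec24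
  have h2 : vec24 2 = 1 := by simp [vec24]
  have h4 : vec24 4 = -1 := by simp [vec24]
  rw [polar_vec24, h2, h4, nsmul_eq_mul] at h
  push_cast at h
  linarith

/-- The element of the spin group over `swapPerm`. -/
def swapSpin : CliffordAlgebra minkowski :=
  CliffordAlgebra.ι minkowski vec13 * CliffordAlgebra.ι minkowski vec24

theorem star_swapSpin : star swapSpin
    = CliffordAlgebra.ι minkowski vec24 * CliffordAlgebra.ι minkowski vec13 := by
  simp [swapSpin, CliffordAlgebra.star_ι]

theorem ι_mem_lipschitz (v : Fin 11 → ℝ) (hv : minkowski v ≠ 0) :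
    CliffordAlgebra.ι minkowski v
      ∈ (lipschitzGroup minkowski).toSubmonoid.map (Units.coeHom _) := by
  have hu : IsUnit (CliffordAlgebra.ι minkowski v) :=
    CliffordAlgebra.isUnit_ι_of_isUnit _ hv.isUnit
  obtain ⟨u, hu⟩ := hu
  exact ⟨u, Subgroup.subset_closure ⟨v, hu.symm⟩, hu⟩

theorem swapSpin_mem : swapSpin ∈ spinGroup minkowski := by
  have h13 := CliffordAlgebra.ι_sq_scalar minkowski vec13
  have h24 := CliffordAlgebra.ι_sq_scalar minkowski vec24
  rw [minkowski_vec13, Algebra.algebraMap_eq_smul_one] at h13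
  rw [minkowski_vec24, Algebra.algebraMap_eq_smul_one] at h24
  refine ⟨⟨mul_mem (ι_mem_lipschitz _ ?_) (ι_mem_lipschitz _ ?_), ?_⟩, ?_⟩
  · rw [minkowski_vec13]; norm_num
  · rw [minkowski_vec24]; norm_num
  · change swapSpin ∈ unitary _
    rw [Unitary.mem_iff, star_swapSpin, swapSpin]
    constructor
    · rw [mul_assoc, ← mul_assoc (CliffordAlgebra.ι minkowski vec13), h13, smul_mul_assoc, one_mul,
        mul_smul_comm, h24, smul_smul]
      norm_num
    · rw [mul_assoc, ← mul_assoc (CliffordAlgebra.ι minkowski vec24), h24, smul_mul_assoc, one_mul,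
        mul_smul_comm, h13, smul_smul]
      norm_num
  · exact CliffordAlgebra.ι_mul_ι_mem_evenOdd_zero minkowski _ _

theorem cliffordι_injective : Function.Injective (CliffordAlgebra.ι minkowski) := by
  intro v w h
  have h2 := congrArg (fun x => ExteriorAlgebra.ιInv (CliffordAlgebra.equivExterior minkowski x)) h
  simpa [CliffordAlgebra.equivExterior, CliffordAlgebra.changeForm_ι,
    ExteriorAlgebra.ι_leftInverse _] using h2

/-- Sandwiching v between two copies of a vector a gives -Q(a) times the reflection of v. For the
two vectors the signs cancel and the norms multiply to 1. -/
theorem vectorRep_swapSpin_mulVec (v : Fin 11 → ℝ) :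
    (vectorRep swapSpin).mulVec v = v ∘ swapPerm := by
  apply cliffordι_injective
  rw [ι_vectorRep_mulVec _ swapSpin_mem, star_swapSpin, swapSpin]
  have h : ∀ a b c : CliffordAlgebra minkowski, a * b * c * (b * a) = a * (b * c * b) * a :=
    fun a b c => by simp only [mul_assoc]
  rw [h, CliffordAlgebra.ι_mul_ι_mul_ι, CliffordAlgebra.ι_mul_ι_mul_ι, minkowski_vec13,
    minkowski_vec24, polar_vec13, polar_vec24]
  congr 1
  funext i
  fin_cases i <;>
    simp [vec13, vec24, swapPerm, Equiv.swap_apply_def, Fin.ext_iff] <;> ring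

theorem vectorRep_swapSpin :
    vectorRep swapSpin = Matrix.of fun a b => if swapPerm a = b then 1 else 0 := by
  ext a b
  have h := congrFun (vectorRep_swapSpin_mulVec (Pi.single b 1)) a
  rw [Matrix.mulVec_single_one] at h
  simpa [Pi.single_apply] using h

/-- The contraction with the dual of `e^1 e^2 e^3 e^4`. -/
def contr1234 : CE →ₗ[ℝ] CE :=
  contr (bosCov [4]) ∘ₗ contr (bosCov [3]) ∘ₗ contr (bosCov [2]) ∘ₗ contr (bosCov [1])

theorem contr1234_apply (w : CE) : contr1234 w
    = contr (bosCov [4]) (contr (bosCov [3]) (contr (bosCov [2]) (contr (bosCov [1]) w))) := rfl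

theorem counit_act (S : SpinorMat) (L : Matrix (Fin 11) (Fin 11) ℝ) (w : CE) :
    counit (act S L w) = counit w := by
  have h : counit.comp (act S L) = counit := by
    refine algHom_ext fun x => ?_
    cases x <;> simp [act_gen, actGen, psi, phi, counit_gen]
  exact DFunLike.congr_fun h w

/-- Invariance makes the coefficient of `e^{1} e^{2} e^{3} e^{4} e^{12567} e^{34567}` vanish. -/
theorem coeffBC_eq_zero {P : CE} (hP : IsSpinInvariant P) : coeffBC (contr1234 P) = 0 := by
  have h := hP swapSpin swapSpin_mem
  rw [vectorRep_swapSpin] at h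
  have h1 : [1].map swapPerm.symm = [3] := by decide
  have h2 : [2].map swapPerm.symm = [4] := by decide
  have h3 : [3].map swapPerm.symm = [1] := by decide
  have h4 : [4].map swapPerm.symm = [2] := by decide
  have hB : (List.ofFn idxB).map swapPerm.symm = List.ofFn idxC := by decide
  have hC : (List.ofFn idxC).map swapPerm.symm = List.ofFn idxB := by decide
  -- The reordering 3412 → 1234 is even, taking four anticommutations, whereas exchanging B and C
  -- takes one.
  have key : coeffBC (contr1234 P) = -coeffBC (contr1234 P) := by
    nth_rewrite 1 [← h]
    simp only [coeffBC, contr1234_apply, LinearMap.comp_apply, AlgHom.toLinearMap_apply,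
      contr_act_perm, counit_act, h1, h2, h3, h4, hB, hC]
    rw [contr_contr (bosCov (List.ofFn idxB)), map_neg]
    congr 3
    rw [contr_contr (bosCov [1]) (bosCov [4]), contr_contr (bosCov [1]) (bosCov [3])]
    simp only [map_neg, neg_neg]
    rw [contr_contr (bosCov [2]) (bosCov [4]), contr_contr (bosCov [2]) (bosCov [3])]
    simp only [map_neg, neg_neg]
  linarith

/-! ## The obstruction for the seven-form -/

/-! ### Reduction to the generators ψ and e^a -/

/-- The values of `kill` on the generators. -/
def killGen : Gen → CE
  | .e p t => if p.1 = 1 then gen (.e p t) else 0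
  | .psi α => psi α
  | .phi _ => 0

/-- The homomorphism annihilating `e^{ab}`, `e^{a_1 ⋯ a_5}` and `φ`. -/
def kill : CE →ₐ[ℝ] CE :=
  liftCE killGen
    (by
      intro p t σ
      dsimp only [killGen]
      split_ifs
      · exact gen_skew p t σ
      · simp)
    (by
      intro x y
      cases x <;> cases y <;> dsimp only [killGen] <;> (try split_ifs) <;>
        first
        | exact gen_comm _ _
        | simp)

theorem kill_e (p : Rank) (t : Fin p.1 → Fin 11) :
    kill (gen (.e p t)) = if p.1 = 1 then gen (.e p t) else 0 := liftCE_gen _ _ _ _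
theorem kill_psi (α : SpinorIdx) : kill (psi α) = psi α := liftCE_gen _ _ _ _
theorem kill_phi (α : SpinorIdx) : kill (phi α) = 0 := liftCE_gen _ _ _ _
theorem kill_e1 (a : Fin 11) : kill (e1 a) = e1 a := by rw [e1, kill_e, if_pos rfl]
theorem kill_e2 (a b : Fin 11) : kill (e2 a b) = 0 := by rw [e2, kill_e, if_neg (by decide)]
theorem kill_e5 (t : Fin 5 → Fin 11) : kill (e5 t) = 0 := by rw [e5, kill_e, if_neg (by decide)]

theorem counit_kill (w : CE) : counit (kill w) = counit w := by
  have h : counit.comp kill = counit := by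
    refine algHom_ext fun x => ?_
    cases x with
    | e p t => simp [kill_e, apply_ite counit, counit_gen]
    | psi α => change counit (kill (psi α)) = _; rw [kill_psi]; rfl
    | phi α => change counit (kill (phi α)) = _; rw [kill_phi, map_zero, counit_gen]
  exact DFunLike.congr_fun h w

/-- The hypothesis says that `v` does not see the annihilated generators, so contraction descends to
the quotient by them. -/
theorem contr_kill {k : ℕ} (v : Covector k)
    (hv : ∀ x, kill (gen x) = gen x ∨ kill (gen x) = 0 ∧ v.val x = 0) (w : CE) :
    contr v (kill w) = kill (contr v w) := by
  refine linearMap_eq_of_gen_mul (contr v ∘ₗ kill.toLinearMap) (kill.toLinearMap ∘ₗ contr v)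
    (by simp [contr_one]) ?_ w
  intro y x ih
  simp only [LinearMap.comp_apply, AlgHom.toLinearMap_apply] at ih ⊢
  rw [map_mul kill, contr_gen_mul, map_add, map_smul, map_smul, map_mul kill]
  rcases hv y with h | ⟨h, h'⟩
  · rw [h, contr_gen_mul, ih]
  · simp [h, h']

theorem contr_singleton_kill (a : Fin 11) (w : CE) :
    contr (bosCov [a]) (kill w) = kill (contr (bosCov [a]) w) := by
  refine contr_kill _ (fun x => ?_) w
  cases x with
  | e p t =>
    by_cases h : p.1 = 1
    · exact Or.inl (by rw [kill_e, if_pos h])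
    · exact Or.inr ⟨by rw [kill_e, if_neg h], bosForm_eq_zero _ _ _ (by simpa using h)⟩
  | psi α => exact Or.inl (kill_psi α)
  | phi α => exact Or.inr ⟨kill_phi α, rfl⟩

theorem contr_psi_kill (α : SpinorIdx) (w : CE) :
    contr (psiCov α) (kill w) = kill (contr (psiCov α) w) := by
  refine contr_kill _ (fun x => ?_) w
  cases x with
  | e p t =>
    by_cases h : p.1 = 1
    · exact Or.inl (by rw [kill_e, if_pos h])
    · exact Or.inr ⟨by rw [kill_e, if_neg h], rfl⟩
  | psi α => exact Or.inl (kill_psi α)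
  | phi α => exact Or.inr ⟨kill_phi α, rfl⟩

theorem contr1234_kill (w : CE) : contr1234 (kill w) = kill (contr1234 w) := by
  simp only [contr1234_apply, contr_singleton_kill]

theorem quadContr_kill (N : SpinorMat) (w : CE) : quadContr N (kill w) = kill (quadContr N w) := by
  simp only [quadContr_apply, contr_psi_kill, map_sum, map_smul]

theorem contr_contr1234 (v : Covector 0) (w : CE) :
    contr v (contr1234 w) = contr1234 (contr v w) := by
  rw [contr1234_apply, contr1234_apply, contr_contr v (bosCov [4]), contr_contr v (bosCov [3]),
    contr_contr v (bosCov [2]), contr_contr v (bosCov [1])]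
  simp only [map_neg, neg_neg]

theorem contr1234_d (w : CE) : contr1234 (d (-1) w) = d (-1) (contr1234 w) := by
  simp only [contr1234_apply, contr_d, map_neg, neg_neg]

theorem kill_P3 (s : ℝ) : kill (P3 s) = 0 := by
  simp [P3, bil, kill_e2, kill_e5, kill_phi]

theorem contr_five_e1_mul (l : List (Fin 11)) (hl : l.length = 5) (a : Fin 11) (w : CE) :
    contr (bosCov l) (e1 a * w) = -(e1 a * contr (bosCov l) w) := by
  rw [e1, contr_gen_mul, passSign_zero, bosCov_val, bosForm_eq_zero _ _ _ (by simp [hl])]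
  simp

theorem contr_five_e2_mul (l : List (Fin 11)) (hl : l.length = 5) (a b : Fin 11) (w : CE) :
    contr (bosCov l) (e2 a b * w) = -(e2 a b * contr (bosCov l) w) := by
  rw [e2, contr_gen_mul, passSign_zero, bosCov_val, bosForm_eq_zero _ _ _ (by simp [hl])]
  simp

theorem contr_e5_mul (l : List (Fin 11)) (t : Fin 5 → Fin 11) (w : CE) :
    contr (bosCov l) (e5 t * w)
      = bosForm l (.e ⟨5, by decide⟩ t) • w - e5 t * contr (bosCov l) w := by
  rw [e5, contr_gen_mul, passSign_zero, bosCov_val, neg_one_smul, sub_eq_add_neg]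

theorem contr_bos_psi_mul (l : List (Fin 11)) (α : SpinorIdx) (w : CE) :
    contr (bosCov l) (psi α * w) = -(psi α * contr (bosCov l) w) := by
  rw [psi, contr_gen_mul, passSign_zero, bosCov_val, bosForm_psi]
  simp

theorem contr_bos_phi_mul (l : List (Fin 11)) (α : SpinorIdx) (w : CE) :
    contr (bosCov l) (phi α * w) = -(phi α * contr (bosCov l) w) := by
  rw [phi, contr_gen_mul, passSign_zero, bosCov_val, bosForm_phi]
  simp

/-- The only term of P_3 with a single five-index generator is the β₃ term, which retains φ. Every
other term retains some e^{ab}, e^{a_1⋯a_5} or φ as well. -/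
theorem kill_contr_P3 (l : List (Fin 11)) (hl : l.length = 5) (s : ℝ) :
    kill (contr (bosCov l) (P3 s)) = 0 := by
  simp only [P3, bil, map_add, map_smul, map_sum, Finset.sum_mul, smul_mul_assoc, mul_assoc,
    contr_five_e1_mul l hl, contr_five_e2_mul l hl, contr_e5_mul, contr_bos_psi_mul,
    contr_bos_phi_mul, map_neg, map_sub, map_mul, kill_e2, kill_e5, kill_phi, zero_mul, mul_zero,
    smul_zero, neg_zero, sub_zero, Finset.sum_const_zero, add_zero]

theorem contr_five_G4_mul (l : List (Fin 11)) (hl : l.length = 5) (w : CE) :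
    contr (bosCov l) (G4 * w) = G4 * contr (bosCov l) w := by
  simp only [G4, Finset.sum_mul, smul_mul_assoc, map_smul, map_sum, mul_assoc,
    contr_bil_psi_mul, contr_five_e1_mul l hl, mul_neg, neg_neg]

theorem contr_five_G7 (l : List (Fin 11)) (hl : l.length = 5) : contr (bosCov l) G7 = 0 := by
  have h : ∀ t : Fin 5 → Fin 11,
      contr (bosCov l) (List.ofFn fun i => e1 (t i)).prod = 0 := by
    intro t
    simp only [List.ofFn_succ, List.ofFn_zero, List.prod_cons, List.prod_nil,
      contr_five_e1_mul l hl, contr_one, mul_zero, neg_zero]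
  simp only [G7, map_smul, map_sum, contr_bil_psi_mul, h, mul_zero, Finset.sum_const_zero,
    smul_zero]

/-- The right-hand side of the equation for the six-form. -/
def sevenForm : CE := G7 - (1 / 2 : ℝ) • (G4 * P3 (-1))

theorem kill_bil_psi (M : SpinorMat) : kill (bil psi M psi) = bil psi M psi := by
  simp [bil, kill_psi]

theorem kill_list_e1 (t : Fin 5 → Fin 11) :
    kill (List.ofFn fun i => e1 (t i)).prod = (List.ofFn fun i => e1 (t i)).prod := by
  simp [List.ofFn_succ, kill_e1]

theorem kill_sevenForm : kill sevenForm = G7 := by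
  simp only [sevenForm, map_sub, map_smul, map_mul, kill_P3, mul_zero, smul_zero, sub_zero]
  simp only [G7, map_smul, map_sum, map_mul, kill_bil_psi, kill_list_e1]

theorem pairing_five_sevenForm (N : SpinorMat) (l : List (Fin 11)) (hl : l.length = 5) :
    pairing N l (contr1234 sevenForm) = 0 := by
  -- The augmentation factors through `kill`, which commutes with the contractions in ψ and e^a but
  -- not with the five-index one; the latter is therefore performed first.
  rw [pairing_apply, contr_contr1234, ← counit_kill, ← quadContr_kill, ← contr1234_kill]
  have h : kill (contr (bosCov l) sevenForm) = 0 := by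
    rw [sevenForm, map_sub, contr_five_G7 l hl, map_smul, contr_five_G4_mul l hl, zero_sub,
      map_neg, map_smul, map_mul, kill_contr_P3 l hl, mul_zero, smul_zero, neg_zero]
  rw [h]
  simp

/-- If a ψ-derivative hits `w`, one of the two leading ψ's survives and the augmentation annihilates
the term. -/
theorem counit_quadContr_psi_mul (N : SpinorMat) (α γ : SpinorIdx) (w : CE) :
    counit (quadContr N (psi α * psi γ * w)) = quadVal N (.psi α) (.psi γ) * counit w := by
  rw [← counit_quadContr, mul_assoc]
  simp only [quadContr_apply, psi, contr_gen_mul, contr_gen, map_add, map_smul, map_sum, map_mul,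
    counit_gen, zero_mul, smul_eq_mul, mul_zero, add_zero, map_one, mul_one, Finset.sum_mul, add_mul,
    mul_assoc]

theorem counit_quadContr_bil_mul {S : SpinorMat}
    (hS : (spinorMetric * S).transpose = spinorMetric * S) (M : SpinorMat) (w : CE) :
    counit (quadContr (spinorMetric * S) (bil psi M psi * w))
      = 2 * (S.transpose * M).trace * counit w := by
  simp only [← sum_spinorMetric_mul_quadVal hS, Finset.sum_mul, bil, map_sum, smul_mul_assoc,
    map_smul, counit_quadContr_psi_mul, smul_eq_mul]
  simp only [mul_assoc]

theorem e1_mul_e1 (a b : Fin 11) : e1 a * e1 b = -(e1 b * e1 a) := by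
  rw [e1, e1, gen_comm]
  simp [commSign, Gen.superDeg]

/-! ### Value of the obstruction on the seven-form -/

/-- The coefficient of `e^1 e^2 e^3 e^4 e^5`. -/
def coeff12345 : CE →ₗ[ℝ] ℝ := counit.toLinearMap ∘ₗ contr (bosCov [5]) ∘ₗ contr1234

theorem coeff12345_self : coeff12345 (List.ofFn fun i => e1 (idxA i)).prod = 1 := by
  simp [coeff12345, contr1234_apply, idxA, List.ofFn_succ, e1, contr_gen_mul, contr_gen, bosCov_val,
    bosForm_singleton, passSign_zero]

/-- Only G_7 survives `kill`. Its summands over the reorderings of 12345 are equal, so their number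
5! cancels the prefactor and leaves 2 · 32. -/
theorem pairing_idx5_sevenForm :
    pairing (spinorMetric * cliff idxA) (List.ofFn idx5) (contr1234 sevenForm) = 64 := by
  have h5 : List.ofFn idx5 = [5] := rfl
  rw [pairing_apply, ← counit_kill, ← quadContr_kill, h5, ← contr_singleton_kill, ← contr1234_kill,
    kill_sevenForm]
  have h : ∀ t : Fin 5 → Fin 11, counit (quadContr (spinorMetric * cliff idxA)
      (contr (bosCov [5]) (contr1234 (bil psi (cliff t) psi * (List.ofFn fun i => e1 (t i)).prod))))
      = 64 * (bosForm (List.ofFn idxA) (.e ⟨5, by decide⟩ t) •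
        coeff12345 (List.ofFn fun i => e1 (t i)).prod) := by
    intro t
    simp only [contr1234_apply, contr_bil_psi_mul]
    rw [counit_quadContr_bil_mul idxA_symm,
      trace_cliff (q := ⟨5, by decide⟩) idxA_injective (by decide) ⟨5, by decide⟩ (by decide) t]
    simp only [coeff12345, LinearMap.comp_apply, contr1234_apply, AlgHom.toLinearMap_apply,
      smul_eq_mul]
    ring
  have hsum := sum_bosForm_smul ⟨5, by decide⟩ idxA
    (fun t => coeff12345 (List.ofFn fun i => e1 (t i)).prod) (by
      intro σ
      rw [← map_smul, ← prod_ofFn_comp_perm _ fun i j _ => e1_mul_e1 (idxA i) (idxA j)]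
      rfl)
  simp only [G7, map_smul, map_sum, h, ← Finset.mul_sum]
  erw [hsum]
  rw [coeff12345_self]
  norm_num [Nat.factorial]

theorem obstruction_sevenForm : obstruction (contr1234 sevenForm) = 64 := by
  simp only [obstruction, LinearMap.add_apply, pairing_idx5_sevenForm,
    pairing_five_sevenForm _ _ (List.length_ofFn (f := idxA)),
    pairing_five_sevenForm _ _ (List.length_ofFn (f := idxB)), add_zero]

end HiddenM

end

theorem mainTheorem7 :
    ¬ ∃ P : HiddenM.CE, P ∈ HiddenM.forms 6 ∧ HiddenM.IsSpinInvariant P ∧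
      HiddenM.d (-1) P
        = HiddenM.G7 - (1 / 2 : ℝ) • (HiddenM.G4 * HiddenM.P3 (-1)) := by
  rintro ⟨P, hP, hinv, hd⟩
  have hQ : HiddenM.contr1234 P ∈ HiddenM.forms 2 :=
    HiddenM.contr_forms _ 2 (HiddenM.contr_forms _ 3 (HiddenM.contr_forms _ 4
      (HiddenM.contr_forms _ 5 hP)))
  have h := HiddenM.obstruction_d hQ
  have hd' : HiddenM.d (-1) P = HiddenM.sevenForm := hd
  -- Both evaluations of the obstruction on dQ combine to 64 = -64 · 0.
  rw [← HiddenM.contr1234_d, hd', HiddenM.obstruction_sevenForm,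
    HiddenM.coeffBC_eq_zero hinv] at h
  norm_num at h
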